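/- We identify a scheme with the sheaf of sets that it represents on the big étale site of schemes. An étale equivalence relation in schemes is a pair of étale morphisms of schemes $p_1,p_2:R\rightrightarrows U$ such that $R\to U\times U$ is a monomorphism and $R(T)\subseteq U(T)\times U(T)$ is an equivalence relation for every scheme $T$. An algebraic space is an étale sheaf on the category of schemes that is isomorphic to the quotient sheaf $U/R$ (the étale sheafification of $T\mapsto U(T)/R(T)$) of some étale equivalence relation in schemes $R\rightrightarrows U$; no quasi-compactness or quasi-separatedness is required. A map $X\to Y$ of contravariant functors on schemes is representable if $X\times_Y T$ is a scheme for every scheme $T$ and every map $T\to Y$. A map from a scheme to an algebraic space is étale if it is representable and all its base changes along maps from schemes are étale morphisms of schemes. A map $f:X\to Y$ of algebraic spaces is étale if, for all schemes $V,W$, all étale maps $V\to X$ and $W\to Y$, and every morphism $h:V\to W$ such that $V\to X\to Y$ equals $V\xrightarrow{h} W\to Y$, the morphism $h$ is étale. An étale equivalence relation in algebraic spaces is a pair of étale maps of algebraic spaces $R\rightrightarrows U$ such that $R\to U\times U$ is a monomorphism and $R(T)\subseteq U(T)\times U(T)$ is an equivalence relation for every scheme $T$. (1) For every algebraic space $X$,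 the diagonal $\Delta_X:X\to X\times_{\operatorname{Spec}\mathbf Z}X$ is representable. More generally, for every map $X\to S$ of algebraic spaces, the relative diagonal $\Delta_{X/S}:X\to X\times_S X$ is representable. (2) If $R\rightrightarrows U$ is an étale equivalence relation in algebraic spaces, then the quotient sheaf $X=U/R$ for the étale topology exists and is an algebraic space. -/

import Mathlib

open CategoryTheory Limits AlgebraicGeometry

universe u

/-- `q : U ⟶ X` exhibits `X` as the quotient sheaf `U/R` on the big étale site of schemes:
`X` is an étale sheaf, `q` coequalizes the two projections `p₁, p₂ : R ⟶ U`, and the induced map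
from the presheaf coequalizer (sectionwise `T ↦ U(T)/R(T)` if `R` is an equivalence relation) to
`X` is a sheafification, i.e. it is locally injective and locally surjective. -/
structure IsEtaleQuotient {R U X : Scheme.{u}ᵒᵖ ⥤ Type u} (p₁ p₂ : R ⟶ U) (q : U ⟶ X) :
    Prop where
  isSheaf : Presheaf.IsSheaf Scheme.etaleTopology.{u} X
  condition : p₁ ≫ q = p₂ ≫ q
  isLocallyInjective :
    Presheaf.IsLocallyInjective Scheme.etaleTopology.{u} (coequalizer.desc q condition)
  isLocallySurjective :
    Presheaf.IsLocallySurjective Scheme.etaleTopology.{u} (coequalizer.desc q condition)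

/-- An étale equivalence relation in schemes: an equivalence relation in the category of schemes
(i.e. `R ⟶ U × U` is a monomorphism and `R(T)` is an equivalence relation on `U(T)` for all
schemes `T`) whose two projections are étale. -/
structure IsSchemeEtaleEquivRel {R U : Scheme.{u}} (p₁ p₂ : R ⟶ U) : Prop where
  isEquivalenceRelation : IsEquivalenceRelation p₁ p₂
  etale_fst : Etale p₁
  etale_snd : Etale p₂

/-- Algebraic spaces (over `Spec ℤ`, without any quasi-separatedness or quasi-compactness
hypothesis): étale sheaves on the category of schemes that are isomorphic to the quotient sheaf
`U/R` of an étale equivalence relation in schemes. Schemes are identified with the sheaves that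
they represent. -/
def IsAlgebraicSpace (X : Scheme.{u}ᵒᵖ ⥤ Type u) : Prop :=
  Presheaf.IsSheaf Scheme.etaleTopology.{u} X ∧
    ∃ (R U : Scheme.{u}) (p₁ p₂ : R ⟶ U) (q : yoneda.obj U ⟶ X),
      IsSchemeEtaleEquivRel p₁ p₂ ∧ IsEtaleQuotient (yoneda.map p₁) (yoneda.map p₂) q

/-- A map of contravariant functors on schemes is representable if its base change along every map
from a scheme is a scheme. -/
abbrev IsRepresentableMap {X Y : Scheme.{u}ᵒᵖ ⥤ Type u} (f : X ⟶ Y) : Prop :=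
  (yoneda : Scheme.{u} ⥤ _).relativelyRepresentable f

/-- A map `a : V ⟶ X` from a scheme `V` is étale if it is representable and for every scheme `T`
and every map `T ⟶ X` the projection `V ×_X T ⟶ T` is an étale morphism of schemes. -/
abbrev IsEtaleChart {V : Scheme.{u}} {X : Scheme.{u}ᵒᵖ ⥤ Type u} (a : yoneda.obj V ⟶ X) : Prop :=
  MorphismProperty.presheaf @Etale a

/-- Étale maps of algebraic spaces (not required to be representable), defined étale-locally on
source and target: in every commutative square
```
  V --h--> W
  |a       |b
  X --f--> Y
```
with `V`, `W` schemes and `a`, `b` étale, the morphism of schemes `h` is étale. -/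
def IsEtaleMap {X Y : Scheme.{u}ᵒᵖ ⥤ Type u} (f : X ⟶ Y) : Prop :=
  ∀ ⦃V W : Scheme.{u}⦄ (a : yoneda.obj V ⟶ X) (b : yoneda.obj W ⟶ Y) (h : V ⟶ W),
    IsEtaleChart a → IsEtaleChart b → a ≫ f = yoneda.map h ≫ b → Etale h

/-- An étale equivalence relation in algebraic spaces: `R` and `U` are algebraic spaces,
`R ⟶ U × U` is a monomorphism, `R(T)` is an equivalence relation on `U(T)` for all schemes `T`,
and both projections `R ⟶ U` are étale. -/
structure IsEtaleEquivRel {R U : Scheme.{u}ᵒᵖ ⥤ Type u} (p₁ p₂ : R ⟶ U) : Prop where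
  isAlgebraicSpace_rel : IsAlgebraicSpace R
  isAlgebraicSpace_obj : IsAlgebraicSpace U
  isEquivalenceRelation : IsEquivalenceRelation p₁ p₂
  etale_fst : IsEtaleMap p₁
  etale_snd : IsEtaleMap p₂

/-! Everything rests on one representability criterion (`isRepresentable_of_mono`): let `F` be an
étale subsheaf of a scheme `T`, étale-locally covered by a scheme `W` which is locally of finite
type over `T` and has `W ×[T] W ⟶ W` étale. Then `F` is a scheme. When `W ⟶ F` is an étale chart the
last condition is automatic, because `W ×[T] W = W ×[F] W` for a subsheaf `F`.

The criterion is proved without descent for quasi-affine or separated quasi-finite morphisms.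
Locally `W = Spec B` and `T = Spec A`, and the candidate for the quotient of `W` by `W ×[T] W` is
the spectrum of the dominion `C = {b | b ⊗ 1 = 1 ⊗ b}`. By `Algebra.Etale.dominion`, `B` is étale
over `C`, so the image of `Spec B` in `Spec C` is an open subscheme `Z`, and `Z ⟶ T` is a
monomorphism. These `Z` are open subfunctors of `F` and form a Zariski cover of it.

Diagonals: for `T₁, T₂ ⟶ X = U/R`, the fibre product `T₁ ×[X] T₂` is a subsheaf of `T₁ × T₂`. Over
an étale cover of `T₁ × T₂` whose two components lift to `U` it becomes a pullback of `R ⟶ U × U`,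
hence a scheme, and the criterion applies.

Quotients: the sheafification exists in the same universe because sections over `T` are determined
by a small amount of data. If `U₀ ⟶ U` is an étale chart, `R₀ = U₀ ×[X] U₀` is a subsheaf of `U₀ ×
U₀` covered by a scheme étale over it, so `R₀` is a scheme by the criterion. Its projections to `U₀`
are étale because étaleness is étale-local on the source, and `R₀ ⇉ U₀` presents `X`. -/

/-! ### Commutative algebra: étaleness over the dominion. -/

open TensorProduct in
/-- If `A ⟶ B` is a ring map whose base change `B ⟶ B ⊗[A] B` is étale and `e` is an idempotent of
`B` such that `A ⟶ Be` is surjective, then the basic open defined by `e` descends to the dominion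
of `A` in `B`. -/
lemma exists_mem_dominion_of_etale {A B : Type u} [CommRing A] [CommRing B] [Algebra A B]
    [Algebra.Etale B (B ⊗[A] B)] {e : B} (he : IsIdempotentElem e)
    (hsurj : ∀ b : B, ∃ a : A, b * e = algebraMap A B a * e) :
    ∃ c : B, c ⊗ₜ[A] (1 : B) = 1 ⊗ₜ[A] c ∧ c * e = e ∧
      ∀ x : B, x ⊗ₜ[A] (1 : B) = 1 ⊗ₜ[A] x → x * e = 0 → x * c = 0 := by
  -- `M` is the factor `B ⊗[A] Be` of `B ⊗[A] B`. It is étale over `B`, and `B ⟶ M` is surjective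
  -- since `A ⟶ Be` is; so its kernel is generated by an idempotent `k`, and `c = 1 - k` will do.
  let f : B ⊗[A] B := 1 ⊗ₜ (1 - e)
  have hf : IsIdempotentElem f := by
    simp only [IsIdempotentElem, f, Algebra.TensorProduct.tmul_mul_tmul, mul_one, he.one_sub.eq]
  let M := (B ⊗[A] B) ⧸ Ideal.span {f}
  have hmem (x : B ⊗[A] B) : x ∈ Ideal.span {f} ↔ x * (1 - f) = 0 := by
    rw [Ideal.mem_span_singleton]
    constructor
    · rintro ⟨y, rfl⟩
      have := hf.eq
      linear_combination (-y) * this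
    · intro h
      exact ⟨x, by linear_combination h⟩
  have h1f : 1 - f = 1 ⊗ₜ e := by
    simp [f, tmul_sub, Algebra.TensorProduct.one_def]
  have : IsLocalization.Away (1 - f) M :=
    IsLocalization.away_of_isIdempotentElem hf.one_sub (by simp [M, Ideal.mk_ker])
      Ideal.Quotient.mk_surjective
  have : Algebra.Etale (B ⊗[A] B) M := .of_isLocalizationAway (1 - f)
  have : Algebra.Etale B M := .comp B (B ⊗[A] B) M
  have hsM : Function.Surjective (algebraMap B M) := by
    intro x
    obtain ⟨x, rfl⟩ := Ideal.Quotient.mk_surjective x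
    induction x using TensorProduct.induction_on with
    | zero => exact ⟨0, by simp⟩
    | add x y hx hy =>
      obtain ⟨a, ha⟩ := hx
      obtain ⟨b, hb⟩ := hy
      exact ⟨a + b, by simp [ha, hb]⟩
    | tmul b₁ b₂ =>
      obtain ⟨a, ha⟩ := hsurj b₂
      refine ⟨b₁ * algebraMap A B a, ?_⟩
      change Ideal.Quotient.mk _ ((b₁ * algebraMap A B a) ⊗ₜ[A] (1 : B)) = _
      rw [Ideal.Quotient.eq, hmem, h1f, sub_mul, Algebra.TensorProduct.tmul_mul_tmul,
        Algebra.TensorProduct.tmul_mul_tmul, ha, mul_one, mul_one, one_mul, mul_comm b₁,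
        ← Algebra.smul_def, ← Algebra.smul_def, TensorProduct.smul_tmul, sub_self]
  have hker (b : B) : b ∈ RingHom.ker (algebraMap B M) ↔ b ⊗ₜ[A] e = 0 := by
    rw [RingHom.mem_ker]
    change Ideal.Quotient.mk _ (b ⊗ₜ[A] (1 : B)) = _ ↔ _
    rw [Ideal.Quotient.eq_zero_iff_mem, hmem, h1f]
    simp
  obtain ⟨k, hk, hkM⟩ :=
    (Ideal.isIdempotentElem_iff_of_fg _
      (Algebra.FinitePresentation.ker_fG_of_surjective (Algebra.ofId B M) hsM)).mp
      ((Algebra.FormallyEtale.iff_of_surjective hsM).mp inferInstance)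
  have hkM' : RingHom.ker (algebraMap B M) = Ideal.span {k} := hkM
  have hk0 : k ⊗ₜ[A] e = 0 := by
    rw [← hker, hkM']
    exact Ideal.mem_span_singleton_self k
  -- `k` lies in the ideal generated by the kernel of `A ⟶ Be`
  have hkI : k ∈ (RingHom.ker (algebraMap A (B ⧸ Ideal.span {1 - e}))).map (algebraMap A B) := by
    set Q := B ⧸ Ideal.span {1 - e}
    set I := RingHom.ker (algebraMap A Q)
    set J := I.map (algebraMap A B)
    have hsQ : Function.Surjective (Algebra.ofId A Q) := by
      intro x
      obtain ⟨x, rfl⟩ := Ideal.Quotient.mk_surjective x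
      obtain ⟨a, ha⟩ := hsurj x
      refine ⟨a, ?_⟩
      change Ideal.Quotient.mk _ (algebraMap A B a) = _
      rw [Ideal.Quotient.eq, Ideal.mem_span_singleton]
      exact ⟨algebraMap A B a - x, by linear_combination -ha⟩
    let ψ : (A ⧸ RingHom.ker (Algebra.ofId A Q)) →ₐ[A] B ⧸ J :=
      Ideal.Quotient.liftₐ _ (Algebra.ofId A (B ⧸ J)) fun a ha ↦ by
        change Ideal.Quotient.mk _ (algebraMap A B a) = 0
        rw [Ideal.Quotient.eq_zero_iff_mem]
        exact Ideal.mem_map_of_mem _ ha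
    let χ : B →ₐ[A] B ⧸ J :=
      (ψ.comp (Ideal.quotientKerAlgEquivOfSurjective hsQ).symm.toAlgHom).comp
        (Ideal.Quotient.mkₐ A (Ideal.span {1 - e}))
    have hχ : χ e = 1 := by
      have : Ideal.Quotient.mkₐ A (Ideal.span {1 - e}) e = 1 := by
        rw [← map_one (Ideal.Quotient.mkₐ A (Ideal.span {1 - e}))]
        simp only [Ideal.Quotient.mkₐ_eq_mk]
        rw [eq_comm, Ideal.Quotient.eq]
        exact Ideal.mem_span_singleton_self _
      simp only [χ, AlgHom.comp_apply, this, map_one]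
    -- With `I = ker (A ⟶ Be)`, the identification `Be = A/I` gives a map `B ⊗[A] B ⟶ B/IB` sending
    -- `k ⊗ e = 0` to the class of `k`.
    have := congr(Algebra.TensorProduct.lift (Ideal.Quotient.mkₐ A J) χ
      (fun _ _ ↦ Commute.all _ _) $hk0)
    simpa [hχ, Ideal.Quotient.eq_zero_iff_mem] using this
  refine ⟨1 - k, ?_, ?_, ?_⟩
  -- Each `a` in `I` satisfies `a ⊗ e = 1 ⊗ ae = 0`, so it is a multiple of `k` and is killed by `1
  -- - k`; as `k ∈ IB`, the vanishing follows. With its mirror image, `c ⊗ 1` and `1 ⊗ c` both equal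
  -- `c ⊗ c`.
  · have h1 : (1 - k) ⊗ₜ[A] k = 0 := by
      have key (x : B) (hx : x ∈ (RingHom.ker
          (algebraMap A (B ⧸ Ideal.span {1 - e}))).map (algebraMap A B)) :
          (1 - k) ⊗ₜ[A] x = 0 := by
        induction hx using Submodule.span_induction with
        | zero => simp
        | add x y _ _ hx hy => rw [tmul_add, hx, hy, add_zero]
        | smul r x _ hx =>
          have : (1 - k) ⊗ₜ[A] (r • x) = (1 ⊗ₜ r) * ((1 - k) ⊗ₜ[A] x) := by
            simp [Algebra.TensorProduct.tmul_mul_tmul]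
          rw [this, hx, mul_zero]
        | mem x hx =>
          obtain ⟨a, ha, rfl⟩ := hx
          have hae : algebraMap A B a * e = 0 := by
            have : Ideal.Quotient.mk (Ideal.span {1 - e}) (algebraMap A B a) = 0 := ha
            rw [Ideal.Quotient.eq_zero_iff_mem, Ideal.mem_span_singleton] at this
            obtain ⟨y, hy⟩ := this
            rw [hy]
            linear_combination (-y) * he.eq
          have hak : algebraMap A B a ∈ RingHom.ker (algebraMap B M) := by
            rw [hker, ← mul_one (algebraMap A B a), ← Algebra.smul_def, TensorProduct.smul_tmul,
              Algebra.smul_def, hae, tmul_zero]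
          rw [hkM', Ideal.mem_span_singleton] at hak
          obtain ⟨y, hy⟩ := hak
          rw [← mul_one (algebraMap A B a), ← Algebra.smul_def, ← TensorProduct.smul_tmul,
            Algebra.smul_def, hy]
          rw [show k * y * (1 - k) = 0 by linear_combination (-y) * hk.eq, zero_tmul]
      exact key k hkI
    have h2 : k ⊗ₜ[A] (1 - k) = 0 := by
      have := congr(TensorProduct.comm A B B $h1)
      simpa using this
    have e1 : (1 - k) ⊗ₜ[A] (1 : B) = (1 - k) ⊗ₜ[A] (1 - k) := by
      rw [tmul_sub, h1, sub_zero]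
    have e2 : (1 : B) ⊗ₜ[A] (1 - k) = (1 - k) ⊗ₜ[A] (1 - k) := by
      rw [sub_tmul (1 : B) k (1 - k), h2, sub_zero]
    rw [e1, e2]
  · have := congr(Algebra.TensorProduct.lmul' A $hk0)
    simp only [Algebra.TensorProduct.lmul'_apply_tmul, map_zero] at this
    linear_combination -this
  · intro x hx hxe
    have : x ∈ RingHom.ker (algebraMap B M) := by
      rw [hker]
      have : x ⊗ₜ[A] e = (x ⊗ₜ[A] 1) * (1 ⊗ₜ e) := by simp
      rw [this, hx, Algebra.TensorProduct.tmul_mul_tmul, hxe, tmul_zero]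
    rw [hkM', Ideal.mem_span_singleton] at this
    obtain ⟨y, rfl⟩ := this
    linear_combination (-y) * hk.eq

open TensorProduct

/-- The dominion of a ring map `A ⟶ B`: the elements `b` such that `b ⊗ 1 = 1 ⊗ b`. -/
noncomputable def dominion (A B : Type u) [CommRing A] [CommRing B] [Algebra A B] :
    Subalgebra A B :=
  AlgHom.equalizer Algebra.TensorProduct.includeLeft (Algebra.TensorProduct.includeRight (R := A))

section

variable {A B : Type u} [CommRing A] [CommRing B] [Algebra A B]

lemma mem_dominion_iff {x : B} : x ∈ dominion A B ↔ x ⊗ₜ[A] (1 : B) = 1 ⊗ₜ[A] x := Iff.rfl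

lemma Algebra.Etale.tensorProduct_of_tower [Algebra.Etale B (B ⊗[A] B)] (B' : Type u) [CommRing B']
    [Algebra A B'] [Algebra B B'] [IsScalarTower A B B'] : Algebra.Etale B' (B' ⊗[A] B) :=
  .of_equiv (Algebra.TensorProduct.cancelBaseChange A B B' B' B)

lemma Algebra.Etale.tensorProduct_baseChange [Algebra.Etale B (B ⊗[A] B)]
    (E : Type u) [CommRing E] [Algebra A E] :
    Algebra.Etale (E ⊗[A] B) ((E ⊗[A] B) ⊗[E] (E ⊗[A] B)) := by
  let : Algebra B (E ⊗[A] B) := Algebra.TensorProduct.rightAlgebra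
  have := Algebra.Etale.tensorProduct_of_tower (A := A) (B := B) (E ⊗[A] B)
  exact .of_equiv (Algebra.TensorProduct.cancelBaseChange A E (E ⊗[A] B) (E ⊗[A] B) B).symm

lemma KaehlerDifferential.subsingleton_tensorProduct {R S : Type u} [CommRing R] [CommRing S]
    [Algebra R S] (T : Type u) [CommRing T] [Algebra R T]
    [Algebra.FormallyUnramified T (T ⊗[R] S)] : Subsingleton (T ⊗[R] Ω[S⁄R]) :=
  let _ : Algebra S (T ⊗[R] S) := Algebra.TensorProduct.rightAlgebra
  (KaehlerDifferential.tensorKaehlerEquivBase R T S (T ⊗[R] S)).subsingleton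

/-- `B ⊗[A] Ω[B⁄A]` is the module of differentials of `B ⊗[A] B` over `B`, which vanishes, and
scalar multiplication maps it onto `Ω[B⁄A]`. -/
lemma Algebra.FormallyUnramified.of_etale_tensorProduct [Algebra.Etale B (B ⊗[A] B)] :
    Algebra.FormallyUnramified A B := by
  constructor
  have : Subsingleton (B ⊗[A] Ω[B⁄A]) := KaehlerDifferential.subsingleton_tensorProduct B
  have h (z : Ω[B⁄A]) : z = 0 := by
    have := congr((LinearMap.id (R := A) (M := Ω[B⁄A])).liftBaseChange B
      $(Subsingleton.elim ((1 : B) ⊗ₜ[A] z) 0))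
    simpa using this
  exact ⟨fun x y ↦ by rw [h x, h y]⟩

/-- The dominion is the kernel of the `A`-linear map `b ↦ b ⊗ 1 - 1 ⊗ b`, and flat base change
commutes with kernels. -/
lemma mem_range_lTensor_dominion {E : Type u} [CommRing E] [Algebra A E] [Module.Flat A E]
    {x : E ⊗[A] B} (hx : x ∈ dominion E (E ⊗[A] B)) :
    x ∈ Set.range (Algebra.TensorProduct.map (AlgHom.id E E) (dominion A B).val) := by
  have h0 : (Algebra.TensorProduct.includeLeftSubRight A B).lTensor E x = 0 := by
    apply (TensorProduct.AlgebraTensorModule.distribBaseChange A E B B).injective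
    rw [Algebra.TensorProduct.distribBaseChange_includeLeftSubRight_apply, map_zero]
    simp [mem_dominion_iff.mp hx]
  have h1 : x ∈ LinearMap.ker (AlgebraTensorModule.lTensor E E
      (Algebra.TensorProduct.includeLeftSubRight A B)) := h0
  rw [Module.Flat.ker_lTensor_eq] at h1
  obtain ⟨y, rfl⟩ := h1
  have hle : LinearMap.ker (Algebra.TensorProduct.includeLeftSubRight A B) ≤
      (dominion A B).toSubmodule := by
    intro z hz
    have : z ⊗ₜ[A] (1 : B) - 1 ⊗ₜ[A] z = 0 := by simpa using hz
    exact sub_eq_zero.mp this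
  refine ⟨(Submodule.inclusion hle).lTensor E y, ?_⟩
  clear hx h0
  induction y using TensorProduct.induction_on with
  | zero => simp
  | add a b ha hb => simp only [map_add, ha, hb]
  | tmul a b => rfl

lemma map_mem_dominion_baseChange {E : Type u} [CommRing E] [Algebra A E]
    (x : E ⊗[A] dominion A B) :
    Algebra.TensorProduct.map (AlgHom.id E E) (dominion A B).val x ∈ dominion E (E ⊗[A] B) := by
  induction x using TensorProduct.induction_on with
  | zero => simp
  | add a b ha hb => rw [map_add]; exact add_mem ha hb
  | tmul a b =>
    rw [mem_dominion_iff]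
    have := congr(TensorProduct.AlgebraTensorModule.distribBaseChange A E B B
      (a ⊗ₜ $(mem_dominion_iff.mp b.2)))
    simp only [AlgebraTensorModule.distribBaseChange_tmul] at this
    simp only [Algebra.TensorProduct.map_tmul, AlgHom.coe_id, id_eq, Subalgebra.coe_val]
    rw [Algebra.TensorProduct.one_def, this, tmul_eq_smul_one_tmul a (1 : B), smul_tmul, smul_tmul',
      smul_eq_mul, mul_one]

open Algebra in
/-- If `B` is a finite type `A`-algebra and `B ⊗[A] B` is étale over `B`, then `B` is étale over the
dominion of `A` in `B`. -/
theorem Algebra.Etale.dominion [Algebra.FiniteType A B] [Algebra.Etale B (B ⊗[A] B)] :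
    Algebra.Etale (dominion A B) B := by
  have : Algebra.FormallyUnramified A B := .of_etale_tensorProduct
  have key (Q : PrimeSpectrum B) : ∃ f ∉ Q.asIdeal,
      Algebra.Etale (_root_.dominion A B) (Localization.Away f) := by
    -- An unramified algebra is locally a quotient of a standard étale one. Base change to `E =
    -- P.Ring` makes `E ⟶ S = B_f` surjective, the situation of `exists_mem_dominion_of_etale`.
    obtain ⟨f, hfQ, P, φ, hφ⟩ :=
      Algebra.IsUnramifiedAt.exists_hasStandardEtaleSurjectionOn (R := A) Q.asIdeal
    refine ⟨f, hfQ, ?_⟩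
    let C := _root_.dominion A B
    let E := P.Ring
    let S := Localization.Away f
    let B' := E ⊗[A] B
    let C' := E ⊗[A] C
    have : Algebra.Etale A E := inferInstance
    have : Algebra.Etale B' (B' ⊗[E] B') := .tensorProduct_baseChange E
    let ι : C' →ₐ[E] B' := Algebra.TensorProduct.map (AlgHom.id E E) C.val
    have hι : Function.Injective ι :=
      Module.Flat.lTensor_preserves_injective_linearMap (M := E) C.val.toLinearMap
        Subtype.val_injective
    let l : B' →ₐ[A] S :=
      Algebra.TensorProduct.lift φ (IsScalarTower.toAlgHom A B S) fun _ _ ↦ Commute.all _ _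
    have hl (x : E) : l (x ⊗ₜ 1) = φ x := by
      change φ x * IsScalarTower.toAlgHom A B S 1 = _
      rw [map_one, mul_one]
    have hl' (x : B) : l (1 ⊗ₜ x) = algebraMap B S x := by
      change φ 1 * algebraMap B S x = _
      rw [map_one, one_mul]
    have hls : Function.Surjective l := fun x ↦ by
      obtain ⟨x, rfl⟩ := hφ x
      exact ⟨x ⊗ₜ 1, hl x⟩
    let : Algebra B B' := Algebra.TensorProduct.rightAlgebra
    let : Algebra B' S := l.toRingHom.toAlgebra
    have : IsScalarTower B B' S := .of_algebraMap_eq fun x ↦ by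
      exact (hl' x).symm
    have : Algebra.Etale B B' :=
      .of_equiv (A := B ⊗[A] E) { Algebra.TensorProduct.comm A B E with commutes' := fun _ ↦ rfl }
    have : Algebra.Etale B S := .of_isLocalizationAway f
    -- A map between étale `B`-algebras is étale; as `B' ⟶ S` is also surjective, it identifies `S`
    -- with the factor `B'(1 - k)`.
    have : Algebra.Etale B' S := .of_restrictScalars B B' S
    obtain ⟨k, hk, hkM⟩ :=
      (Ideal.isIdempotentElem_iff_of_fg _
        (Algebra.FinitePresentation.ker_fG_of_surjective (Algebra.ofId B' S) hls)).mp
        ((Algebra.FormallyEtale.iff_of_surjective hls).mp inferInstance)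
    have hk0 (x : B') : l x = 0 ↔ x * (1 - k) = 0 := by
      have : x ∈ RingHom.ker (Algebra.ofId B' S).toRingHom ↔ x * (1 - k) = 0 := by
        rw [hkM]
        change x ∈ Ideal.span {k} ↔ _
        rw [Ideal.mem_span_singleton]
        constructor
        · rintro ⟨y, rfl⟩
          linear_combination (-y) * hk.eq
        · exact fun h ↦ ⟨x, by linear_combination h⟩
      exact this
    obtain ⟨c, hc, hce, hcx⟩ := exists_mem_dominion_of_etale (A := E) (B := B') hk.one_sub fun b ↦ by
      obtain ⟨a, ha⟩ := hφ (l b)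
      refine ⟨a, ?_⟩
      have : l (b - a ⊗ₜ 1) = 0 := by rw [map_sub, hl, ha, sub_self]
      rw [hk0] at this
      change b * (1 - k) = a ⊗ₜ 1 * (1 - k)
      linear_combination this
    obtain ⟨c', rfl⟩ := mem_range_lTensor_dominion hc
    let : Algebra C' S := (l.toRingHom.comp ι.toRingHom).toAlgebra
    have hlc : l (ι c') = 1 := by
      have : l (ι c' - 1) = 0 := by
        rw [hk0]
        linear_combination hce
      rwa [map_sub, map_one, sub_eq_zero] at this
    -- Inverting `c'` in `C' = E ⊗[A] C` gives `S`: elements of `E` already hit everything, and an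
    -- element of the dominion that dies in `S` is killed by `c'`. So `C ⟶ C' ⟶ S` is étale.
    have : IsLocalization.Away c' S := by
      refine ⟨?_, ?_, ?_⟩
      · rintro ⟨_, n, rfl⟩
        change IsUnit (l (ι (c' ^ n)))
        simp [hlc]
      · intro z
        obtain ⟨a, rfl⟩ := hφ z
        refine ⟨⟨a ⊗ₜ 1, 1⟩, ?_⟩
        change _ * l (ι (1 : C')) = l (ι (a ⊗ₜ 1))
        rw [map_one, map_one, mul_one]
        exact (hl a).symm
      · intro x y hxy
        refine ⟨⟨c', 1, by simp⟩, hι ?_⟩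
        have h0 : l (ι x - ι y) = 0 := by
          rw [map_sub, sub_eq_zero]
          exact hxy
        rw [hk0] at h0
        have := hcx (ι x - ι y) (by rw [← map_sub]; exact map_mem_dominion_baseChange _) h0
        change ι (c' * x) = ι (c' * y)
        rw [map_mul, map_mul]
        linear_combination this
    let : Algebra C C' := Algebra.TensorProduct.rightAlgebra
    have : Algebra.Etale C' S := .of_isLocalizationAway c'
    have : Algebra.Etale C C' :=
      .of_equiv (A := C ⊗[A] E) { Algebra.TensorProduct.comm A C E with commutes' := fun _ ↦ rfl }
    have : IsScalarTower C C' S := .of_algebraMap_eq fun x ↦ by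
      exact (hl' x).symm
    exact .comp C C' S
  choose f hf hE using key
  rw [← RingHom.etale_algebraMap]
  refine RingHom.Etale.ofLocalizationSpanTarget _ (Set.range f) ?_ ?_
  · by_contra h
    obtain ⟨m, hm, hle⟩ := Ideal.exists_le_maximal _ h
    exact hf ⟨m, hm.isPrime⟩ (hle (Ideal.subset_span ⟨_, rfl⟩))
  · rintro ⟨_, Q, rfl⟩
    have := hE Q
    rw [← IsScalarTower.algebraMap_eq, RingHom.etale_algebraMap]
    exact hE Q

end

/-! ### Étaleness is étale-local on the source. -/

open TensorProduct

/-- A monomorphism of schemes which becomes étale after precomposition with a surjective morphism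
is an open immersion. -/
theorem AlgebraicGeometry.IsOpenImmersion.of_mono_of_etale_comp {P' P Y : Scheme.{u}} (s : P' ⟶ P)
    (i : P ⟶ Y) [Surjective s] [Mono i] [Etale (s ≫ i)] : IsOpenImmersion i := by
  let U : Y.Opens := ⟨Set.range (s ≫ i), (s ≫ i).isOpenMap.isOpen_range⟩
  have hU : Set.range i ⊆ Set.range U.ι := by
    rw [Scheme.Opens.range_ι]
    rintro _ ⟨x, rfl⟩
    obtain ⟨x, rfl⟩ := s.surjective x
    exact ⟨x, by simp⟩
  let i' : P ⟶ U := IsOpenImmersion.lift U.ι i hU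
  have hi' : i' ≫ U.ι = i := IsOpenImmersion.lift_fac U.ι i hU
  have : Mono i' := mono_of_mono_fac hi'
  have : Etale ((s ≫ i') ≫ U.ι) := by rw [Category.assoc, hi']; infer_instance
  have : Etale (s ≫ i') := Etale.of_comp _ U.ι
  have : Surjective (s ≫ i') := ⟨fun ⟨y, x, hx⟩ ↦ ⟨x, by
    apply U.ι.injective
    simp only [← Scheme.Hom.comp_apply, Category.assoc, hi']
    exact hx⟩⟩
  -- Étale surjections are strong epimorphisms, so `i'` is both a strong epimorphism and a
  -- monomorphism.
  have : StrongEpi (s ≫ i') := inferInstance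
  have : StrongEpi i' := strongEpi_of_strongEpi s i'
  have : IsIso i' := isIso_of_mono_of_strongEpi i'
  rw [← hi']
  infer_instance

section

variable {K D D' : Type u} [CommRing K] [CommRing D] [CommRing D'] [Algebra K D] [Algebra D D']
  [Algebra K D'] [IsScalarTower K D D']

/-- If a ring epimorphism becomes étale after composition with a faithfully flat ring map, it is
étale. -/
lemma Algebra.Etale.of_isEpi_of_faithfullyFlat [Algebra.IsEpi K D] [Module.FaithfullyFlat D D']
    [Algebra.Etale K D'] : Algebra.Etale K D := by
  have h1 : Mono (Spec.map (CommRingCat.ofHom (algebraMap K D))) := by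
    have : Epi (CommRingCat.ofHom (algebraMap K D)) :=
      CommRingCat.epi_iff_epi.mpr inferInstance
    exact inferInstanceAs (Mono (Scheme.Spec.map (CommRingCat.ofHom (algebraMap K D)).op))
  have h2 : Surjective (Spec.map (CommRingCat.ofHom (algebraMap D D'))) :=
    ⟨PrimeSpectrum.comap_surjective_of_faithfullyFlat⟩
  have h3 : AlgebraicGeometry.Etale (Spec.map (CommRingCat.ofHom (algebraMap D D')) ≫
      Spec.map (CommRingCat.ofHom (algebraMap K D))) := by
    rw [← Spec.map_comp, HasRingHomProperty.Spec_iff (P := @AlgebraicGeometry.Etale)]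
    simp only [CommRingCat.hom_comp, CommRingCat.hom_ofHom]
    rw [← IsScalarTower.algebraMap_eq, RingHom.etale_algebraMap]
    infer_instance
  have := IsOpenImmersion.of_mono_of_etale_comp (Spec.map (CommRingCat.ofHom (algebraMap D D')))
    (Spec.map (CommRingCat.ofHom (algebraMap K D)))
  have h4 : AlgebraicGeometry.Etale (Spec.map (CommRingCat.ofHom (algebraMap K D))) := inferInstance
  rwa [HasRingHomProperty.Spec_iff (P := @AlgebraicGeometry.Etale), CommRingCat.hom_ofHom,
    RingHom.etale_algebraMap] at h4

/-- `D'` descends to an étale algebra over a finitely generated subalgebra `A` of `D`; once `A` is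
large enough the descended algebra is `D'` itself. Then `D ⊗[A] D' = D'`, so `A ⟶ D` is an
epimorphism by faithful flatness, hence étale, and `D` is of finite type over `K`. -/
lemma Algebra.FiniteType.of_etale_of_faithfullyFlat [Algebra.Etale D D']
    [Module.FaithfullyFlat D D'] [Algebra.FiniteType K D'] : Algebra.FiniteType K D := by
  classical
  obtain ⟨A₀, B₀, _, _, hA₀, _, ⟨e⟩⟩ := Algebra.Etale.exists_subalgebra_fg K D D'
  have key (x : D ⊗[A₀] B₀) : ∃ s : Finset D, ∀ (A : Subalgebra K D), A₀ ≤ A → (s : Set D) ⊆ A →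
      x ∈ Algebra.adjoin K ((fun p : D × B₀ ↦ p.1 ⊗ₜ[A₀] p.2) '' ((A : Set D) ×ˢ Set.univ)) := by
    induction x using TensorProduct.induction_on with
    | zero => exact ⟨∅, fun _ _ _ ↦ zero_mem _⟩
    | add x y hx hy =>
      obtain ⟨s, hs⟩ := hx
      obtain ⟨t, ht⟩ := hy
      refine ⟨s ∪ t, fun A hA hst ↦ ?_⟩
      simp only [Finset.coe_union, Set.union_subset_iff] at hst
      exact add_mem (hs A hA hst.1) (ht A hA hst.2)
    | tmul d b =>
      refine ⟨{d}, fun A _ h ↦ Algebra.subset_adjoin ⟨(d, b), ⟨h (by simp), trivial⟩, rfl⟩⟩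
  obtain ⟨S, hS⟩ := Algebra.FiniteType.out (R := K) (A := D')
  choose t ht using fun x ↦ key (e x)
  -- Adjoining the coefficients in `D` of generators of `D'` makes `A ⊗[A₀] B₀ ⟶ D'` surjective; it
  -- is injective because `B₀` is flat over `A₀`.
  let A : Subalgebra K D := A₀ ⊔ Algebra.adjoin K (S.biUnion t : Set D)
  have hA : A.FG := hA₀.sup ⟨_, rfl⟩
  have hle : A₀ ≤ A := le_sup_left
  let : Algebra A₀ A := (Subalgebra.inclusion hle).toAlgebra
  have : IsScalarTower A₀ A D := .of_algebraMap_eq fun _ ↦ rfl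
  let B := A ⊗[A₀] B₀
  let c : D ⊗[A] B ≃ₐ[D] D' := (Algebra.TensorProduct.cancelBaseChange A₀ A D D B₀).trans e.symm
  let j : B →ₐ[A] D' := (c.toAlgHom.restrictScalars A).comp Algebra.TensorProduct.includeRight
  have hj : Function.Bijective j := by
    refine ⟨c.injective.comp
      (Algebra.TensorProduct.includeRight_injective Subtype.val_injective), ?_⟩
    rw [← Set.range_eq_univ]
    suffices h : (⊤ : Subalgebra K D') ≤ (j.restrictScalars K).range from
      Set.eq_univ_of_forall fun x ↦ h (x := x) trivial
    rw [← hS, Algebra.adjoin_le_iff]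
    intro x hx
    have hx' := ht x A hle fun y hy ↦ (le_sup_right : _ ≤ A)
      (Algebra.subset_adjoin (by simpa using ⟨x, hx, hy⟩))
    have : Algebra.adjoin K ((fun p : D × B₀ ↦ p.1 ⊗ₜ[A₀] p.2) '' ((A : Set D) ×ˢ Set.univ)) ≤
        (j.restrictScalars K).range.comap (e.symm.toAlgHom.restrictScalars K) := by
      rw [Algebra.adjoin_le_iff]
      rintro _ ⟨⟨a, b⟩, ⟨ha, -⟩, rfl⟩
      refine ⟨(⟨a, ha⟩ : A) ⊗ₜ b, ?_⟩
      change e.symm (Algebra.TensorProduct.cancelBaseChange A₀ A D D B₀ (1 ⊗ₜ (_ ⊗ₜ b))) = _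
      rw [Algebra.TensorProduct.cancelBaseChange_tmul, Algebra.smul_def, mul_one]
      rfl
    have := this hx'
    simpa using this
  let j' : B ≃ₐ[A] D' := AlgEquiv.ofBijective j hj
  have : Algebra.Etale A D' := .of_equiv j'
  let h : D ⊗[A] D' ≃ₐ[D] D' := (Algebra.TensorProduct.congr .refl j'.symm).trans c
  have hh (x : D') : h (1 ⊗ₜ x) = x := by
    obtain ⟨x, rfl⟩ := j'.surjective x
    change c (1 ⊗ₜ (j'.symm (j' x))) = c (1 ⊗ₜ x)
    rw [AlgEquiv.symm_apply_apply]
  have : Algebra.IsEpi A D := by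
    rw [Algebra.isEpi_iff_forall_one_tmul_eq]
    intro x
    have h1 : (1 : D) ⊗ₜ[A] algebraMap D D' x = x ⊗ₜ 1 := by
      apply h.injective
      rw [hh]
      exact (h.commutes x).symm
    have h2 := congr(TensorProduct.comm A D D' $h1)
    simp only [TensorProduct.comm_tmul] at h2
    apply Module.FaithfullyFlat.tensorProduct_mk_injective (A := D) (B := D') (D ⊗[A] D)
    apply (Algebra.TensorProduct.cancelBaseChange A D D' D' D).injective
    simp only [TensorProduct.mk_apply, Algebra.TensorProduct.cancelBaseChange_tmul, one_smul]
    rw [← h2, Algebra.smul_def, mul_one]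
  have : Algebra.Etale A D := .of_isEpi_of_faithfullyFlat (D' := D')
  have : Algebra.FiniteType K A := (Subalgebra.fg_iff_finiteType A).mp hA
  exact .trans (S := A) inferInstance inferInstance

/-- Étaleness is étale-local on the source, for ring maps. -/
theorem Algebra.Etale.of_etale_of_faithfullyFlat [Algebra.Etale D D']
    [Module.FaithfullyFlat D D'] [Algebra.Etale K D'] : Algebra.Etale K D := by
  have : Algebra.FiniteType K D := .of_etale_of_faithfullyFlat (D' := D')
  have : Algebra.FormallyUnramified K D := by
    constructor
    have : Subsingleton (D' ⊗[D] Ω[D⁄K]) :=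
      (KaehlerDifferential.tensorKaehlerEquivOfFormallyEtale K D D').subsingleton
    exact Module.FaithfullyFlat.lTensor_reflects_triviality D D' _
  have key (Q : PrimeSpectrum D) : ∃ f ∉ Q.asIdeal, Algebra.Etale K (Localization.Away f) := by
    obtain ⟨f, hfQ, P, φ, hφ⟩ :=
      Algebra.IsUnramifiedAt.exists_hasStandardEtaleSurjectionOn (R := K) Q.asIdeal
    refine ⟨f, hfQ, ?_⟩
    let S := Localization.Away f
    let S' := S ⊗[D] D'
    have : Algebra.Etale K P.Ring := inferInstance
    let : Algebra P.Ring S := φ.toRingHom.toAlgebra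
    have : IsScalarTower K P.Ring S := .of_algebraMap_eq fun x ↦ (φ.commutes x).symm
    have : Algebra.IsEpi P.Ring S := Algebra.isEpi_of_surjective_algebraMap _ _ hφ
    have : Algebra.Etale K S' := by
      let : Algebra D' S' := Algebra.TensorProduct.rightAlgebra
      have : IsScalarTower K D' S' := .of_algebraMap_eq fun x ↦ by
        change algebraMap K S x ⊗ₜ[D] (1 : D') = 1 ⊗ₜ algebraMap K D' x
        rw [IsScalarTower.algebraMap_apply K D S, IsScalarTower.algebraMap_apply K D D',
          Algebra.algebraMap_eq_smul_one, Algebra.algebraMap_eq_smul_one (A := D') (algebraMap K D x), TensorProduct.smul_tmul]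
      have : Algebra.Etale D' S' :=
        .of_equiv (A := D' ⊗[D] S)
          { Algebra.TensorProduct.comm D D' S with commutes' := fun _ ↦ rfl }
      exact .comp K D' S'
    have : Algebra.Etale P.Ring S' := .of_restrictScalars K P.Ring S'
    -- The surjection `P.Ring ⟶ S` is an epimorphism that becomes étale on the faithfully flat cover
    -- `S'`, hence is étale.
    have : Algebra.Etale P.Ring S := .of_isEpi_of_faithfullyFlat (D' := S')
    exact .comp K P.Ring S
  choose f hf hE using key
  rw [← RingHom.etale_algebraMap]
  refine RingHom.Etale.ofLocalizationSpanTarget _ (Set.range f) ?_ ?_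
  · by_contra h
    obtain ⟨m, hm, hle⟩ := Ideal.exists_le_maximal _ h
    exact hf ⟨m, hm.isPrime⟩ (hle (Ideal.subset_span ⟨_, rfl⟩))
  · rintro ⟨_, Q, rfl⟩
    rw [← IsScalarTower.algebraMap_eq, RingHom.etale_algebraMap]
    exact hE Q

end

instance AlgebraicGeometry.Etale.isZariskiLocalAtTarget : IsZariskiLocalAtTarget (@Etale.{u}) :=
  HasRingHomProperty.instIsZariskiLocalAtTarget @Etale

instance AlgebraicGeometry.Etale.isZariskiLocalAtSource : IsZariskiLocalAtSource (@Etale.{u}) :=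
  HasRingHomProperty.instIsZariskiLocalAtSource (P := @Etale)

instance AlgebraicGeometry.Etale.containsIdentities :
    MorphismProperty.ContainsIdentities (@Etale.{u}) :=
  MorphismProperty.IsMultiplicative.toContainsIdentities

/-- Étaleness is étale-local on the source. -/
theorem AlgebraicGeometry.Etale.of_comp_of_surjective {X Y Z : Scheme.{u}} (f : X ⟶ Y) (g : Y ⟶ Z)
    [Etale f] [Surjective f] [Etale (f ≫ g)] : Etale g := by
  wlog hZ : ∃ K, Z = Spec K generalizing X Y Z with H
  · have hf : Etale f := by assumption
    have hs : Surjective f := by assumption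
    have hfg : Etale (f ≫ g) := by assumption
    rw [IsZariskiLocalAtTarget.iff_of_openCover (P := @Etale) Z.affineCover]
    intro i
    have h : IsPullback (pullback.snd f (pullback.fst g (Z.affineCover.f i)) ≫
        pullback.snd g (Z.affineCover.f i)) (pullback.fst f _) (Z.affineCover.f i) (f ≫ g) :=
      ((IsPullback.of_hasPullback f (pullback.fst g (Z.affineCover.f i))).flip.paste_horiz
        (IsPullback.of_hasPullback g (Z.affineCover.f i)).flip)
    have : Etale (pullback.snd f (pullback.fst g (Z.affineCover.f i)) ≫
        pullback.snd g (Z.affineCover.f i)) := MorphismProperty.of_isPullback h.flip ‹_›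
    have : Etale (pullback.snd f (pullback.fst g (Z.affineCover.f i))) :=
      Etale.etale_isStableUnderBaseChange.of_isPullback (.of_hasPullback f _) hf
    exact H (pullback.snd f (pullback.fst g (Z.affineCover.f i)))
      (pullback.snd g (Z.affineCover.f i)) ⟨_, rfl⟩
  obtain ⟨K, rfl⟩ := hZ
  wlog hY : ∃ D, Y = Spec D generalizing X Y with H
  · have hf : Etale f := by assumption
    have hs : Surjective f := by assumption
    have hfg : Etale (f ≫ g) := by assumption
    rw [IsZariskiLocalAtSource.iff_of_openCover (P := @Etale) Y.affineCover]
    intro i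
    have : Etale (pullback.snd f (Y.affineCover.f i) ≫ Y.affineCover.f i ≫ g) := by
      rw [← Category.assoc, ← pullback.condition, Category.assoc]
      exact Etale.etale_comp _ (f ≫ g)
    exact H (pullback.snd f (Y.affineCover.f i)) (Y.affineCover.f i ≫ g) ⟨_, rfl⟩
  obtain ⟨D, rfl⟩ := hY
  wlog hX : ∃ D', X = Spec D' generalizing X with H
  · have hf : Etale f := by assumption
    have hs : Surjective f := by assumption
    have hfg : Etale (f ≫ g) := by assumption
    -- As `Y` is quasi-compact and `f` is open, a quasi-compact open `V` already surjects onto `Y`;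
    -- an affine scheme then covers `V`.
    obtain ⟨V, hV, e⟩ := f.isOpenMap.exists_opens_image_eq_of_prespectralSpace
      f.continuous (by simp) isOpen_univ isCompact_univ
    have : CompactSpace V := isCompact_iff_compactSpace.mp hV
    obtain ⟨X', p, hsurj, hp, _⟩ := Scheme.exists_hom_isAffine_of_isZariskiLocalAtSource @Etale V
    have : Surjective (X'.isoSpec.inv ≫ p ≫ Scheme.Opens.ι V ≫ f) := by
      rw [MorphismProperty.cancel_left_of_respectsIso @Surjective, surjective_iff]
      intro y
      obtain ⟨v, hv, rfl⟩ : y ∈ f '' V := by rw [e]; trivial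
      obtain ⟨x, hx⟩ := p.surjective ⟨v, hv⟩
      exact ⟨x, by simp [hx]⟩
    have : Etale ((X'.isoSpec.inv ≫ p ≫ Scheme.Opens.ι V ≫ f) ≫ g) := by
      simp only [Category.assoc]
      infer_instance
    exact H (X'.isoSpec.inv ≫ p ≫ Scheme.Opens.ι V ≫ f) ⟨_, rfl⟩
  obtain ⟨D', rfl⟩ := hX
  obtain ⟨φ, rfl⟩ := Spec.map_surjective g
  obtain ⟨ψ, rfl⟩ := Spec.map_surjective f
  have hψ : ψ.hom.Etale := HasRingHomProperty.Spec_iff (P := @Etale).mp ‹_›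
  have hφψ : (φ ≫ ψ).hom.Etale :=
    HasRingHomProperty.Spec_iff (P := @Etale).mp (by rwa [Spec.map_comp])
  have hs : Function.Surjective (PrimeSpectrum.comap ψ.hom) := (Spec.map ψ).surjective
  have hff : ψ.hom.FaithfullyFlat := by
    rw [RingHom.FaithfullyFlat.iff_flat_and_comap_surjective]
    exact ⟨Flat.SpecMap_iff.mp inferInstance, hs⟩
  apply HasRingHomProperty.Spec_iff (P := @Etale).mpr
  let := φ.hom.toAlgebra
  let := ψ.hom.toAlgebra
  let := (φ ≫ ψ).hom.toAlgebra
  have : IsScalarTower K D D' := .of_algebraMap_eq fun _ ↦ rfl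
  have : Algebra.Etale D D' := hψ
  have : Algebra.Etale K D' := hφψ
  have : Module.FaithfullyFlat D D' := hff
  exact Algebra.Etale.of_etale_of_faithfullyFlat (K := K) (D' := D')

/-! ### Local factorization into an étale surjection and a monomorphism. -/

open TensorProduct in
/-- If `g : W ⟶ T` is a morphism of finite type between affine schemes such that `W ×[T] W ⟶ W` is
étale, then `g` factors as an étale surjection followed by a monomorphism. -/
theorem AlgebraicGeometry.exists_etale_surjective_mono_factorization {W T E : Scheme.{u}}
    {g : W ⟶ T} {p₁ p₂ : E ⟶ W} (h : IsPullback p₁ p₂ g g)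
    [IsAffine W] [IsAffine T] [LocallyOfFiniteType g] [Etale p₁] :
    ∃ (Z : Scheme.{u}) (π : W ⟶ Z) (j : Z ⟶ T),
      Etale π ∧ Surjective π ∧ Mono j ∧ π ≫ j = g := by
  wlog hT : ∃ A, T = Spec A generalizing T with H
  · have hft : LocallyOfFiniteType g := by assumption
    have hE : Etale p₁ := by assumption
    obtain ⟨Z, π, j, h₁, h₂, h₃, h₄⟩ := H (g := g ≫ T.isoSpec.hom)
      (h.of_iso (.refl _) (.refl _) (.refl _) T.isoSpec (by simp) (by simp) (by simp) (by simp))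
      ⟨_, rfl⟩
    exact ⟨Z, π, j ≫ T.isoSpec.inv, h₁, h₂, inferInstance, by rw [reassoc_of% h₄]; simp⟩
  obtain ⟨A, rfl⟩ := hT
  wlog hW : ∃ D, W = Spec D generalizing W with H
  · have hft : LocallyOfFiniteType g := by assumption
    have hE : Etale p₁ := by assumption
    obtain ⟨Z, π, j, h₁, h₂, h₃, h₄⟩ := H (g := W.isoSpec.inv ≫ g)
      (p₁ := p₁ ≫ W.isoSpec.hom) (p₂ := p₂ ≫ W.isoSpec.hom)
      (h.of_iso (.refl _) W.isoSpec W.isoSpec (.refl _) (by simp) (by simp) (by simp) (by simp))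
      ⟨_, rfl⟩
    exact ⟨Z, W.isoSpec.hom ≫ π, j, inferInstance, inferInstance, h₃, by simp [h₄]⟩
  obtain ⟨D, rfl⟩ := hW
  obtain ⟨φ, rfl⟩ := Spec.map_surjective g
  algebraize [φ.hom]
  have hφ : φ = CommRingCat.ofHom (algebraMap A D) := rfl
  have : Algebra.FiniteType A D := by
    have := HasRingHomProperty.Spec_iff (P := @LocallyOfFiniteType) (φ := φ) |>.mp ‹_›
    exact this
  have : Algebra.Etale D (D ⊗[A] D) := by
    have h' : Etale (Spec.map (CommRingCat.ofHom
        (Algebra.TensorProduct.includeLeftRingHom : D →+* D ⊗[A] D))) := by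
      have : Etale (pullback.fst (Spec.map φ) (Spec.map φ)) := by
        rw [← h.isoPullback_inv_fst]
        infer_instance
      rw [← pullbackSpecIso_inv_fst]
      exact Etale.etale_comp _ _
    have h'' := HasRingHomProperty.Spec_iff (P := @Etale).mp h'
    rw [CommRingCat.hom_ofHom] at h''
    exact (RingHom.etale_algebraMap ..).mp h''
  have hE : Algebra.Etale (dominion A D) D := Algebra.Etale.dominion
  let C := CommRingCat.of (dominion A D)
  let p : Spec D ⟶ Spec C := Spec.map (CommRingCat.ofHom (algebraMap (dominion A D) D))
  let q : Spec C ⟶ Spec A := Spec.map (CommRingCat.ofHom (algebraMap A (dominion A D)))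
  have hpq : p ≫ q = Spec.map φ := by
    rw [hφ]
    simp only [p, q, ← Spec.map_comp]
    rfl
  have : Etale p := HasRingHomProperty.Spec_iff (P := @Etale).mpr
    (show (algebraMap (dominion A D) D).Etale from (RingHom.etale_algebraMap ..).mpr hE)
  have hglue : pullback.fst (Spec.map φ) (Spec.map φ) ≫ p =
      pullback.snd (Spec.map φ) (Spec.map φ) ≫ p := by
    rw [← cancel_epi (pullbackSpecIso A D D).inv]
    have h₁ : (pullbackSpecIso A D D).inv ≫ pullback.fst (Spec.map φ) (Spec.map φ) = _ :=
      pullbackSpecIso_inv_fst A D D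
    have h₂ : (pullbackSpecIso A D D).inv ≫ pullback.snd (Spec.map φ) (Spec.map φ) = _ :=
      pullbackSpecIso_inv_snd A D D
    rw [← Category.assoc, ← Category.assoc, h₁, h₂, ← Spec.map_comp, ← Spec.map_comp]
    congr 1
    ext x
    exact mem_dominion_iff.mp x.2
  -- Only over the image of `p` can points be lifted to `Spec D`, so monicity is proved on this open
  -- part of `Spec C`.
  let V : (Spec C).Opens := ⟨Set.range p, p.isOpenMap.isOpen_range⟩
  let π : Spec D ⟶ V := IsOpenImmersion.lift V.ι p (by simp [V])
  have hπ : π ≫ V.ι = p := IsOpenImmersion.lift_fac _ _ _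
  have hπE : Etale π := by
    have : Etale (π ≫ V.ι) := by rwa [hπ]
    exact Etale.of_comp π V.ι
  have hπs : Surjective π := by
    rw [surjective_iff]
    rintro ⟨_, x, rfl⟩
    refine ⟨x, V.ι.injective ?_⟩
    rw [← Scheme.Hom.comp_apply, hπ]
    rfl
  refine ⟨V, π, V.ι ≫ q, hπE, hπs, ⟨fun {T'} a b hab ↦ ?_⟩, by rw [reassoc_of% hπ, hpq]⟩
  -- After an étale cover, `a` and `b` lift to `x, y` into `Spec D`. These agree in `Spec A`, so
  -- they factor through the fibre square, whose two projections `p` equalizes by definition of the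
  -- dominion.
  obtain ⟨T'', t, x, y, hx, hy, hte⟩ : ∃ (T'' : Scheme.{u}) (t : T'' ⟶ T') (x y : T'' ⟶ Spec D),
      x ≫ π = t ≫ a ∧ y ≫ π = t ≫ b ∧ Epi t := by
    refine ⟨_, pullback.fst (pullback.snd π a) (pullback.snd π b) ≫ pullback.snd π a,
      pullback.fst (pullback.snd π a) (pullback.snd π b) ≫ pullback.fst π a,
      pullback.snd (pullback.snd π a) (pullback.snd π b) ≫ pullback.fst π b, ?_, ?_, inferInstance⟩
    · rw [Category.assoc, Category.assoc, pullback.condition (f := π) (g := a)]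
    · rw [pullback.condition (f := pullback.snd π a), Category.assoc, Category.assoc,
        pullback.condition (f := π) (g := b)]
  have hxy : x ≫ Spec.map φ = y ≫ Spec.map φ := by
    rw [← hpq, ← hπ, Category.assoc, reassoc_of% hx, reassoc_of% hy, hab]
  rw [← cancel_epi t, ← cancel_mono V.ι, ← hx, ← hy, Category.assoc, Category.assoc, hπ]
  have := pullback.lift x y hxy ≫= hglue
  rwa [pullback.lift_fst_assoc, pullback.lift_snd_assoc] at this

/-! ### Descent for étale sheaves along étale surjections. -/

namespace AlgebraicGeometry

namespace Scheme

theorem etaleTopology_le_fppfTopology : etaleTopology.{u} ≤ fppfTopology :=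
  grothendieckTopology_monotone fun _ _ _ (_ : Etale _) ↦ ⟨inferInstance, inferInstance⟩

instance : etaleTopology.{u}.Subcanonical := .of_le etaleTopology_le_fppfTopology

theorem isSheaf_etaleTopology_yoneda (T : Scheme.{u}) :
    Presheaf.IsSheaf etaleTopology (yoneda.obj T) := by
  rw [isSheaf_iff_isSheaf_of_type]
  exact GrothendieckTopology.Subcanonical.isSheaf_of_isRepresentable _

theorem generate_singleton_mem_etaleTopology {T' T : Scheme.{u}} (f : T' ⟶ T) [Etale f]
    [Surjective f] : Sieve.generate (Presieve.singleton f) ∈ etaleTopology T :=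
  Precoverage.generate_mem_toGrothendieck
    ((singleton_mem_precoverage_iff _ _).mpr ⟨f.surjective, ‹_›⟩)

end Scheme

open Scheme

variable {F G X : Scheme.{u}ᵒᵖ ⥤ Type u} {T T' : Scheme.{u}}

theorem isSheafFor_singleton_of_etale (hF : Presheaf.IsSheaf etaleTopology F) (f : T' ⟶ T)
    [Etale f] [Surjective f] : Presieve.IsSheafFor F (.singleton f) :=
  ((isSheaf_iff_isSheaf_of_type _ _).mp hF).isSheafFor _ (generate_singleton_mem_etaleTopology f)

theorem hom_ext_of_etale_surjective (hF : Presheaf.IsSheaf etaleTopology F) (f : T' ⟶ T)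
    [Etale f] [Surjective f] {a b : yoneda.obj T ⟶ F}
    (h : yoneda.map f ≫ a = yoneda.map f ≫ b) : a = b := by
  apply yonedaEquiv.injective
  apply Presieve.isSeparatedFor_singleton.mp (isSheafFor_singleton_of_etale hF f).isSeparatedFor
  rw [yonedaEquiv_naturality, yonedaEquiv_naturality, h]

theorem hom_ext_of_openCover (hF : Presheaf.IsSheaf etaleTopology F) (𝒰 : T.OpenCover)
    {a b : yoneda.obj T ⟶ F}
    (h : ∀ i, yoneda.map (𝒰.f i) ≫ a = yoneda.map (𝒰.f i) ≫ b) : a = b := by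
  apply yonedaEquiv.injective
  refine (((isSheaf_iff_isSheaf_of_type _ _).mp hF).isSheafFor (.ofArrows 𝒰.X 𝒰.f)
    (zariskiTopology_le_etaleTopology _ 𝒰.mem_grothendieckTopology)).isSeparatedFor.ext ?_
  rintro _ _ ⟨i⟩
  rw [yonedaEquiv_naturality, yonedaEquiv_naturality, h]

theorem exists_desc_of_etale_surjective (hF : Presheaf.IsSheaf etaleTopology F) (f : T' ⟶ T)
    [Etale f] [Surjective f] (s : yoneda.obj T' ⟶ F)
    (hs : ∀ ⦃Z : Scheme.{u}⦄ (g₁ g₂ : Z ⟶ T'), g₁ ≫ f = g₂ ≫ f →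
      yoneda.map g₁ ≫ s = yoneda.map g₂ ≫ s) :
    ∃ t : yoneda.obj T ⟶ F, yoneda.map f ≫ t = s := by
  obtain ⟨y, hy, -⟩ := Presieve.isSheafFor_singleton.mp (isSheafFor_singleton_of_etale hF f)
    (yonedaEquiv s) fun g₁ g₂ h ↦ by
      rw [yonedaEquiv_naturality, yonedaEquiv_naturality, hs g₁ g₂ h]
  refine ⟨yonedaEquiv.symm y, yonedaEquiv.injective ?_⟩
  rw [← yonedaEquiv_naturality, Equiv.apply_symm_apply, hy]

theorem exists_factorization_of_etale_surjective (hF : Presheaf.IsSheaf etaleTopology F)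
    (hG : Presheaf.IsSheaf etaleTopology G) (i : F ⟶ G) [Mono i] (f : T' ⟶ T)
    [Etale f] [Surjective f] (t : yoneda.obj T ⟶ G) (s : yoneda.obj T' ⟶ F)
    (h : s ≫ i = yoneda.map f ≫ t) :
    ∃ t' : yoneda.obj T ⟶ F, t' ≫ i = t := by
  obtain ⟨t', ht'⟩ := exists_desc_of_etale_surjective hF f s fun Z g₁ g₂ hg ↦ by
    rw [← cancel_mono i, Category.assoc, Category.assoc, h, ← Functor.map_comp_assoc, hg,
      Functor.map_comp_assoc]
  refine ⟨t', hom_ext_of_etale_surjective hG f ?_⟩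
  rw [reassoc_of% ht', h]

/-- Sections of the target of an étale-locally surjective map from a scheme lift along a single
étale surjection. -/
theorem exists_etale_surjective_lift (hX : Presheaf.IsSheaf etaleTopology X) {U : Scheme.{u}}
    (q : yoneda.obj U ⟶ X) [Presheaf.IsLocallySurjective etaleTopology q] (t : yoneda.obj T ⟶ X) :
    ∃ (T' : Scheme.{u}) (f : T' ⟶ T) (s : T' ⟶ U), Etale f ∧ Surjective f ∧
      yoneda.map s ≫ q = yoneda.map f ≫ t := by
  have hmem : Presheaf.imageSieve q (yonedaEquiv t) ∈ etaleTopology T :=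
    Presheaf.imageSieve_mem etaleTopology q _
  obtain ⟨𝒰, h𝒰⟩ := mem_grothendieckTopology_iff.mp hmem
  have key (i : 𝒰.I₀) : ∃ s : 𝒰.X i ⟶ U, yoneda.map s ≫ q = yoneda.map (𝒰.f i) ≫ t := by
    obtain ⟨s, hs⟩ := h𝒰 _ _ ⟨i⟩
    refine ⟨s, yonedaEquiv.injective ?_⟩
    rw [yonedaEquiv_comp, ← yonedaEquiv_naturality, yonedaEquiv_yoneda_map]
    exact hs
  choose s hs using key
  obtain ⟨hsurj, hE⟩ := (singleton_mem_precoverage_iff _ _).mp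
    (𝒰.presieve₀_sigma ▸ 𝒰.sigma.mem₀)
  -- The disjoint union turns the covering family into one étale surjection.
  refine ⟨∐ 𝒰.X, Sigma.desc 𝒰.f, Sigma.desc s, hE, ⟨hsurj⟩, ?_⟩
  refine hom_ext_of_openCover hX (sigmaOpenCover 𝒰.X) fun i ↦ ?_
  have h₁ : (sigmaOpenCover 𝒰.X).f i ≫ Sigma.desc s = s i := Sigma.ι_desc ..
  have h₂ : (sigmaOpenCover 𝒰.X).f i ≫ Sigma.desc 𝒰.f = 𝒰.f i := Sigma.ι_desc ..
  rw [← Functor.map_comp_assoc, ← Functor.map_comp_assoc, h₁, h₂]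
  exact hs i

theorem isLocallySurjective_of_exists_lift (q : F ⟶ X)
    (H : ∀ ⦃T : Scheme.{u}⦄ (t : yoneda.obj T ⟶ X), ∃ (T' : Scheme.{u}) (f : T' ⟶ T)
      (s : yoneda.obj T' ⟶ F), Etale f ∧ Surjective f ∧ s ≫ q = yoneda.map f ≫ t) :
    Presheaf.IsLocallySurjective etaleTopology q where
  imageSieve_mem {T} t := by
    obtain ⟨T', f, s, _, _, h⟩ := H (yonedaEquiv.symm t)
    refine etaleTopology.superset_covering ?_ (generate_singleton_mem_etaleTopology f)
    rw [Sieve.generate_le_iff]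
    rintro _ _ ⟨⟩
    refine ⟨yonedaEquiv s, ?_⟩
    rw [← yonedaEquiv_comp, h, ← yonedaEquiv_naturality, Equiv.apply_symm_apply]

end AlgebraicGeometry

/-! ### Equivalence relations, kernel pairs and quotient sheaves. -/

namespace CategoryTheory

variable {C : Type*} [Category* C]

/-- The relation on morphisms into the target of an equivalence relation is an equivalence
relation. -/
theorem IsEquivalenceRelation.equivalence {R U : C} (p₁ p₂ : R ⟶ U)
    (h : IsEquivalenceRelation p₁ p₂) (T : C) :
    _root_.Equivalence fun x y : T ⟶ U ↦ ∃ r : T ⟶ R, r ≫ p₁ = x ∧ r ≫ p₂ = y := by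
  obtain ⟨e⟩ := h.nonempty_equivalenceRelation
  refine ⟨fun x ↦ ⟨x ≫ e.r, by simp, by simp⟩, ?_, ?_⟩
  · rintro x y ⟨r, rfl, rfl⟩
    exact ⟨r ≫ e.s, by rw [Category.assoc, e.symmetry₁], by rw [Category.assoc, e.symmetry₂]⟩
  · rintro x y z ⟨r, rfl, rfl⟩ ⟨s, hs, rfl⟩
    let w := PullbackCone.IsLimit.lift e.isLimit r s hs.symm
    have h₁ : w ≫ e.c.fst = r := PullbackCone.IsLimit.lift_fst ..
    have h₂ : w ≫ e.c.snd = s := PullbackCone.IsLimit.lift_snd ..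
    exact ⟨w ≫ e.t, by rw [Category.assoc, e.transitivity₁, reassoc_of% h₁],
      by rw [Category.assoc, e.transitivity₂, reassoc_of% h₂]⟩

theorem IsEquivalenceRelation.hom_ext {R U : C} {p₁ p₂ : R ⟶ U}
    (h : IsEquivalenceRelation p₁ p₂) {T : C} {f g : T ⟶ R} (h₁ : f ≫ p₁ = g ≫ p₁)
    (h₂ : f ≫ p₂ = g ≫ p₂) : f = g := by
  obtain ⟨e⟩ := h.nonempty_equivalenceRelation
  exact e.right_cancellation _ _ h₁ h₂

/-- A kernel pair in a category with pullbacks is an equivalence relation. -/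
theorem IsKernelPair.isEquivalenceRelation [HasPullbacks C] {R U X : C} {p₁ p₂ : R ⟶ U}
    {q : U ⟶ X} (h : IsKernelPair q p₁ p₂) : IsEquivalenceRelation p₁ p₂ :=
  ⟨⟨h.equivalenceRelation _ _ _ (pullback.isLimit p₂ p₁)⟩⟩

theorem IsEquivalenceRelation.map_yoneda {C : Type*} [Category.{u} C] {R U : C} {p₁ p₂ : R ⟶ U}
    (h : IsEquivalenceRelation p₁ p₂) :
    IsEquivalenceRelation (yoneda.map p₁) (yoneda.map p₂) := by
  obtain ⟨e⟩ := h.nonempty_equivalenceRelation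
  have : JointlyMono₂ (yoneda.map p₁) (yoneda.map p₂) := ⟨fun Y f g h₁ h₂ ↦ by
    ext T y
    exact e.right_cancellation _ _ congr($(h₁).app T y) congr($(h₂).app T y)⟩
  exact ⟨⟨{ this, e.toReflexiveRelation.map yoneda, e.toSymmetricRelation.map yoneda,
    e.toTransitiveRelation.map yoneda with }⟩⟩

theorem IsKernelPair.of_map_yoneda {C : Type*} [Category.{u} C] [HasPullbacks C]
    {R U : C} {X : Cᵒᵖ ⥤ Type u} {p₁ p₂ : R ⟶ U} {q : yoneda.obj U ⟶ X}
    (h : IsKernelPair q (yoneda.map p₁) (yoneda.map p₂)) : IsEquivalenceRelation p₁ p₂ := by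
  refine ⟨⟨?_⟩⟩
  have hw {T : C} (a b : T ⟶ U) (hab : yoneda.map a ≫ q = yoneda.map b ≫ q) :
      ∃ r : T ⟶ R, r ≫ p₁ = a ∧ r ≫ p₂ = b := by
    obtain ⟨r, hr⟩ := yoneda.map_surjective (h.lift _ _ hab)
    refine ⟨r, yoneda.map_injective ?_, yoneda.map_injective ?_⟩
    · rw [Functor.map_comp, hr, h.lift_fst]
    · rw [Functor.map_comp, hr, h.lift_snd]
  have hm {T : C} (r : T ⟶ R) : yoneda.map (r ≫ p₁) ≫ q = yoneda.map (r ≫ p₂) ≫ q := by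
    simp [h.w]
  choose l hl₁ hl₂ using @hw
  exact
    { right_cancellation := fun T f g h₁ h₂ ↦ yoneda.map_injective
        (h.hom_ext (by simp [← Functor.map_comp, h₁]) (by simp [← Functor.map_comp, h₂]))
      r := l (𝟙 _) (𝟙 _) rfl
      reflexivity₁ := hl₁ _ _ _
      reflexivity₂ := hl₂ _ _ _
      s := l p₂ p₁ h.w.symm
      symmetry₁ := hl₁ _ _ _
      symmetry₂ := hl₂ _ _ _
      c := _
      isLimit := pullback.isLimit p₂ p₁
      t := l (pullback.fst p₂ p₁ ≫ p₁) (pullback.snd p₂ p₁ ≫ p₂) (by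
        rw [hm, pullback.condition, hm])
      transitivity₁ := hl₁ _ _ _
      transitivity₂ := hl₂ _ _ _ }

/-- Two sections with the same image in the presheaf quotient are related. -/
theorem IsEquivalenceRelation.exists_of_coequalizer_π_eq {C : Type*} [Category.{u} C]
    {R U : Cᵒᵖ ⥤ Type u} {p₁ p₂ : R ⟶ U} (h : IsEquivalenceRelation p₁ p₂) {T : C}
    {x y : yoneda.obj T ⟶ U} (hxy : x ≫ coequalizer.π p₁ p₂ = y ≫ coequalizer.π p₁ p₂) :
    ∃ r : yoneda.obj T ⟶ R, r ≫ p₁ = x ∧ r ≫ p₂ = y := by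
  -- The presheaf coequalizer is computed sectionwise, so over `T` it maps to the set quotient
  -- `U(T)/R(T)`, where equality means being related.
  let S : Setoid (U.obj (Opposite.op T)) :=
    (⟨_, h.equivalence p₁ p₂ (yoneda.obj T)⟩ : Setoid (yoneda.obj T ⟶ U)).comap yonedaEquiv.symm
  let ev := (evaluation Cᵒᵖ (Type u)).obj (Opposite.op T)
  let hc := isColimitCoforkMapOfIsColimit ev (coequalizer.condition p₁ p₂)
    (coequalizerIsCoequalizer p₁ p₂)
  let g : ev.obj U ⟶ _root_.Quotient S := ↾(_root_.Quotient.mk S)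
  have hg : ev.map p₁ ≫ g = ev.map p₂ ≫ g := by
    ext r
    refine _root_.Quotient.sound ⟨yonedaEquiv.symm r, ?_, ?_⟩ <;>
    · apply yonedaEquiv.injective
      rw [yonedaEquiv_comp]
      simp [ev]
      rfl
  let d := Cofork.IsColimit.desc hc g hg
  have hd : ev.map (coequalizer.π p₁ p₂) ≫ d = g := Cofork.IsColimit.π_desc' hc g hg
  have h₁ (z : yoneda.obj T ⟶ U) :
      d (yonedaEquiv (z ≫ coequalizer.π p₁ p₂)) = _root_.Quotient.mk S (yonedaEquiv z) := by
    rw [yonedaEquiv_comp]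
    exact congr($hd (yonedaEquiv z))
  obtain ⟨r, hr₁, hr₂⟩ := _root_.Quotient.exact ((h₁ x).symm.trans (hxy ▸ h₁ y))
  exact ⟨r, by simpa using hr₁, by simpa using hr₂⟩

end CategoryTheory

theorem CategoryTheory.isPullback_of_forall_yoneda {C : Type*} [Category.{u} C]
    {P A B X : Cᵒᵖ ⥤ Type u} {fst : P ⟶ A} {snd : P ⟶ B} {f : A ⟶ X} {g : B ⟶ X}
    (w : fst ≫ f = snd ≫ g)
    (hext : ∀ ⦃T : C⦄ (a b : yoneda.obj T ⟶ P), a ≫ fst = b ≫ fst → a ≫ snd = b ≫ snd → a = b)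
    (hex : ∀ ⦃T : C⦄ (x : yoneda.obj T ⟶ A) (y : yoneda.obj T ⟶ B), x ≫ f = y ≫ g →
      ∃ r, r ≫ fst = x ∧ r ≫ snd = y) : IsPullback fst snd f g := by
  refine .of_forall_isPullback_app fun T ↦ (Types.isPullback_iff ..).mpr ⟨?_, ?_, ?_⟩
  · exact congr($(w).app T)
  · intro x y ⟨h₁, h₂⟩
    apply (yonedaEquiv (X := T.unop)).symm.injective
    refine hext _ _ (yonedaEquiv.injective ?_) (yonedaEquiv.injective ?_) <;>
    simpa only [yonedaEquiv_comp, Equiv.apply_symm_apply]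
  · intro x y h
    obtain ⟨r, hr₁, hr₂⟩ := hex (T := T.unop) (yonedaEquiv.symm x) (yonedaEquiv.symm y)
      (yonedaEquiv.injective (by simpa only [yonedaEquiv_comp, Equiv.apply_symm_apply]))
    refine ⟨yonedaEquiv r, ?_, ?_⟩
    · rw [← Equiv.apply_symm_apply (yonedaEquiv (X := T.unop)) x, ← hr₁, yonedaEquiv_comp]
    · rw [← Equiv.apply_symm_apply (yonedaEquiv (X := T.unop)) y, ← hr₂, yonedaEquiv_comp]

namespace IsEtaleQuotient

open Scheme

variable {R U X : Scheme.{u}ᵒᵖ ⥤ Type u} {p₁ p₂ : R ⟶ U} {q : U ⟶ X}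

theorem isLocallySurjective_π (hq : IsEtaleQuotient p₁ p₂ q) :
    Presheaf.IsLocallySurjective etaleTopology q := by
  have := hq.isLocallySurjective
  have : Presheaf.IsLocallySurjective etaleTopology (coequalizer.π p₁ p₂) :=
    Presheaf.isLocallySurjective_of_surjective _ _ fun T ↦ by
      rw [← epi_iff_surjective]
      infer_instance
  rw [← coequalizer.π_desc q hq.condition]
  infer_instance

/-- Equality in `X` means being related étale-locally. The local witnesses are unique since `R ⟶ U ×
U` is mono, so they glue in the sheaf `R`. -/
theorem exists_rel (hq : IsEtaleQuotient p₁ p₂ q) (h : IsEquivalenceRelation p₁ p₂)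
    (hR : Presheaf.IsSheaf etaleTopology R) (hU : Presheaf.IsSheaf etaleTopology U)
    {T : Scheme.{u}} {x y : yoneda.obj T ⟶ U} (hxy : x ≫ q = y ≫ q) :
    ∃ r : yoneda.obj T ⟶ R, r ≫ p₁ = x ∧ r ≫ p₂ = y := by
  have := hq.isLocallyInjective
  let S : Sieve T := Presheaf.equalizerSieve (F := coequalizer p₁ p₂) (X := Opposite.op T)
    (yonedaEquiv (x ≫ coequalizer.π p₁ p₂))
    (yonedaEquiv (y ≫ coequalizer.π p₁ p₂))
  have hS : S ∈ etaleTopology T := by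
    refine Presheaf.equalizerSieve_mem etaleTopology (coequalizer.desc q hq.condition)
      (X := Opposite.op T) _ _ ?_
    rw [← yonedaEquiv_comp, ← yonedaEquiv_comp, Category.assoc, Category.assoc,
      coequalizer.π_desc, hxy]
  have key {Z : Scheme.{u}} (g : Z ⟶ T) (hg : S.arrows g) :
      ∃ r : yoneda.obj Z ⟶ R, r ≫ p₁ = yoneda.map g ≫ x ∧ r ≫ p₂ = yoneda.map g ≫ y := by
    refine h.exists_of_coequalizer_π_eq (yonedaEquiv.injective ?_)
    rw [Category.assoc, Category.assoc, ← yonedaEquiv_naturality, ← yonedaEquiv_naturality]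
    exact hg
  choose r hr₁ hr₂ using @key
  let fam : Presieve.FamilyOfElements R S.arrows := fun Z g hg ↦ yonedaEquiv (r g hg)
  have hfam : fam.Compatible := by
    rw [Presieve.compatible_iff_sieveCompatible]
    intro Y Z f g hf
    simp only [fam]
    rw [yonedaEquiv_naturality]
    congr 1
    apply h.hom_ext <;> simp [hr₁, hr₂]
  have hRS := (isSheaf_iff_isSheaf_of_type _ _).mp hR _ hS
  have hUS := ((isSheaf_iff_isSheaf_of_type _ _).mp hU _ hS).isSeparatedFor
  have hs {Z : Scheme.{u}} (g : Z ⟶ T) (hg : S.arrows g) :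
      yoneda.map g ≫ yonedaEquiv.symm (hRS.amalgamate fam hfam) = r g hg := by
    apply yonedaEquiv.injective
    rw [← yonedaEquiv_naturality, Equiv.apply_symm_apply, hRS.valid_glue hfam g hg]
  refine ⟨yonedaEquiv.symm (hRS.amalgamate fam hfam), yonedaEquiv.injective (hUS.ext ?_),
    yonedaEquiv.injective (hUS.ext ?_)⟩ <;>
  · intro Z g hg
    simp only [yonedaEquiv_naturality, reassoc_of% hs g hg, hr₁, hr₂]

theorem isKernelPair (hq : IsEtaleQuotient p₁ p₂ q) (h : IsEquivalenceRelation p₁ p₂)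
    (hR : Presheaf.IsSheaf etaleTopology R) (hU : Presheaf.IsSheaf etaleTopology U) :
    IsKernelPair q p₁ p₂ :=
  isPullback_of_forall_yoneda hq.condition (fun _ _ _ h₁ h₂ ↦ h.hom_ext h₁ h₂)
    fun _ _ _ hxy ↦ hq.exists_rel h hR hU hxy

/-- For a kernel pair the map from the presheaf coequalizer is injective on sections, before any
localization. -/
theorem of_isKernelPair (hX : Presheaf.IsSheaf etaleTopology X) (h : IsKernelPair q p₁ p₂)
    [Presheaf.IsLocallySurjective etaleTopology q] : IsEtaleQuotient p₁ p₂ q where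
  isSheaf := hX
  condition := h.w
  isLocallySurjective :=
    Presheaf.isLocallySurjective_of_isLocallySurjective_fac _ (coequalizer.π_desc q h.w)
  isLocallyInjective := by
    refine Presheaf.isLocallyInjective_of_injective _ _ fun T ↦ ?_
    have hπ : Function.Surjective ((coequalizer.π p₁ p₂).app T) := by
      rw [← epi_iff_surjective]
      infer_instance
    intro a b hab
    obtain ⟨x, rfl⟩ := hπ a
    obtain ⟨y, rfl⟩ := hπ b
    have hd (z : U.obj T) : (coequalizer.desc q h.w).app T ((coequalizer.π p₁ p₂).app T z) =
        q.app T z := congr($(coequalizer.π_desc q h.w).app T z)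
    rw [hd, hd] at hab
    obtain ⟨r, rfl, rfl⟩ := ((Types.isPullback_iff ..).mp (h.app T)).2.2 x y hab
    exact congr($(coequalizer.condition p₁ p₂).app T r)

end IsEtaleQuotient

/-! ### The representability criterion for subsheaves of a scheme. -/

namespace AlgebraicGeometry

open Scheme

theorem Etale.pullback_snd_self {W T : Scheme.{u}} (g : W ⟶ T) [Etale (pullback.fst g g)] :
    Etale (pullback.snd g g) := by
  rw [← pullbackSymmetry_hom_comp_fst]
  infer_instance

theorem Etale.of_isPullback_comp {P A Y W T : Scheme.{u}} {a : P ⟶ A} {b : P ⟶ Y} {α : A ⟶ T}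
    {s : Y ⟶ W} {g : W ⟶ T} (h : IsPullback a b α (s ≫ g)) [Etale (pullback.snd α g)] :
    Etale b := by
  have h' : IsPullback (pullback.lift a (b ≫ s) (by simp [h.w])) b (pullback.snd α g) s :=
    .of_right (by rwa [pullback.lift_fst]) (pullback.lift_snd _ _ _)
      (IsPullback.of_hasPullback α g)
  exact Etale.etale_isStableUnderBaseChange.of_isPullback h' ‹_›

/-- Locally on `W`, a morphism of finite type `g : W ⟶ T` with `W ×[T] W ⟶ W` étale factors as an
étale surjection followed by a monomorphism. -/
theorem exists_affineOpens_mono_factorization {W T : Scheme.{u}} (g : W ⟶ T)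
    [LocallyOfFiniteType g] [Etale (pullback.fst g g)] (x : W) :
    ∃ (V : W.Opens) (Z : Scheme.{u}) (π : V.toScheme ⟶ Z) (j : Z ⟶ T),
      x ∈ V ∧ Etale π ∧ Surjective π ∧ Mono j ∧ π ≫ j = V.ι ≫ g := by
  obtain ⟨U, hU, hxU, -⟩ := exists_isAffineOpen_mem_and_subset (U := ⊤) (x := g x) trivial
  obtain ⟨V, hV, hxV, hVU⟩ := exists_isAffineOpen_mem_and_subset (U := g ⁻¹ᵁ U) (x := x) hxU
  let g' := g.resLE U V hVU
  have hg' : g' ≫ U.ι = V.ι ≫ g := g.resLE_comp_ι hVU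
  have : IsAffine V := hV
  have : IsAffine U := hU
  have : LocallyOfFiniteType (g' ≫ U.ι) := by rw [hg']; infer_instance
  have : LocallyOfFiniteType g' := locallyOfFiniteType_of_comp g' U.ι
  have : Etale (pullback.fst g' g') := by
    have : Etale (pullback.fst g' g' ≫ V.ι) := by
      have : pullback.map g' g' g g V.ι V.ι U.ι hg' hg' ≫ pullback.fst g g =
        pullback.fst g' g' ≫ V.ι := pullback.lift_fst _ _ _
      rw [← this]
      infer_instance
    exact Etale.of_comp _ V.ι
  obtain ⟨Z, π, j, _, _, _, h⟩ :=
    exists_etale_surjective_mono_factorization (IsPullback.of_hasPullback g' g')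
  exact ⟨V, Z, π, j ≫ U.ι, hxV, ‹_›, ‹_›, inferInstance, by rw [reassoc_of% h, hg']⟩

/-- An étale subsheaf of a scheme `T` which is étale-locally covered by a scheme `W` of finite type
over `T` with `W ×[T] W ⟶ W` étale is a scheme. -/
theorem isRepresentable_of_mono {F : Scheme.{u}ᵒᵖ ⥤ Type u} (hF : Presheaf.IsSheaf etaleTopology F)
    {T W : Scheme.{u}} (i : F ⟶ yoneda.obj T) [Mono i] (w : yoneda.obj W ⟶ F)
    [Presheaf.IsLocallySurjective etaleTopology w] (g : W ⟶ T) (hg : w ≫ i = yoneda.map g)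
    [LocallyOfFiniteType g] [Etale (pullback.fst g g)] : F.IsRepresentable := by
  choose V Z π j hxV hπE hπS hj hfac using exists_affineOpens_mono_factorization g
  have hz (x : W) : ∃ z : yoneda.obj (Z x) ⟶ F, z ≫ i = yoneda.map (j x) :=
    exists_factorization_of_etale_surjective hF (isSheaf_etaleTopology_yoneda T) i (π x) _
      (yoneda.map (V x).ι ≫ w) (by rw [Category.assoc, hg, ← Functor.map_comp, ← Functor.map_comp,
        hfac])
  choose z hz using hz
  have hπz (x : W) : yoneda.map (π x) ≫ z x = yoneda.map (V x).ι ≫ w := by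
    rw [← cancel_mono i, Category.assoc, hz, Category.assoc, hg, ← Functor.map_comp,
      ← Functor.map_comp, hfac]
  have hpb (x : W) {Y : Scheme.{u}} (h : yoneda.obj Y ⟶ F) (t : Y ⟶ T)
      (ht : h ≫ i = yoneda.map t) :
      IsPullback (yoneda.map (pullback.fst (j x) t)) (yoneda.map (pullback.snd (j x) t)) (z x) h := by
    have := (IsPullback.of_hasPullback (j x) t).map yoneda
    rw [← hz, ← ht] at this
    refine ⟨⟨?_⟩, ⟨PullbackCone.IsLimit.mk _ (fun s ↦ this.lift s.fst s.snd ?_) (by simp) (by simp)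
      fun s m h₁ h₂ ↦ this.hom_ext (by simpa using h₁) (by simpa using h₂)⟩⟩
    · simpa [← cancel_mono i] using this.w
    · rw [s.condition_assoc]
  -- On an étale cover `Y'` of `Y` that lifts to `W`, `V ×[T] Y' ⟶ Y'` is a base change of an étale
  -- map. So the monomorphism `Z ×[T] Y ⟶ Y` becomes étale after an étale surjection onto its
  -- source, and is an open immersion.
  have hopen (x : W) {Y : Scheme.{u}} (h : yoneda.obj Y ⟶ F) (t : Y ⟶ T)
      (ht : h ≫ i = yoneda.map t) : IsOpenImmersion (pullback.snd (j x) t) := by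
    obtain ⟨Y', f, s, _, _, hs⟩ := exists_etale_surjective_lift hF w h
    have hst : s ≫ g = f ≫ t := by
      apply yoneda.map_injective
      rw [Functor.map_comp, Functor.map_comp, ← hg, ← ht, reassoc_of% hs]
    let P₁ := pullback (pullback.snd (j x) t) f
    let a : P₁ ⟶ Z x := pullback.fst _ _ ≫ pullback.fst (j x) t
    have hP₁ : IsPullback a (pullback.snd _ _) (j x) (f ≫ t) :=
      (IsPullback.of_hasPullback (pullback.snd (j x) t) f).flip.paste_vert
        (IsPullback.of_hasPullback (j x) t).flip |>.flip
    have hP₂ : IsPullback (pullback.fst (π x) a) (pullback.snd (π x) a ≫ pullback.snd _ _)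
        (π x ≫ j x) (f ≫ t) :=
      (IsPullback.of_hasPullback (π x) a).flip.paste_horiz hP₁.flip |>.flip
    rw [hfac, ← hst] at hP₂
    have : Etale (pullback.snd g g) := Etale.pullback_snd_self g
    have : Etale (pullback.snd ((V x).ι ≫ g) g) := by
      have : pullback.map ((V x).ι ≫ g) g g g (V x).ι (𝟙 _) (𝟙 _) (by simp) (by simp) ≫
        pullback.snd g g = pullback.snd ((V x).ι ≫ g) g :=
        (pullback.lift_snd _ _ _).trans (Category.comp_id _)
      rw [← this]
      infer_instance
    have := Etale.of_isPullback_comp hP₂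
    have : Etale ((pullback.snd (π x) a ≫ pullback.fst (pullback.snd (j x) t) f) ≫
        pullback.snd (j x) t) := by
      rw [Category.assoc, pullback.condition, ← Category.assoc]
      exact Etale.etale_comp _ _
    exact .of_mono_of_etale_comp (pullback.snd (π x) a ≫ pullback.fst (pullback.snd (j x) t) f) _
  have hF' : Presheaf.IsSheaf zariskiTopology F := by
    rw [isSheaf_iff_isSheaf_of_type] at hF ⊢
    exact Presieve.isSheaf_of_le F zariskiTopology_le_etaleTopology hF
  have hz' (x : W) : IsOpenImmersion.presheaf (z x) := .of_exists fun Y h ↦ by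
    obtain ⟨t, ht⟩ := yoneda.map_surjective (h ≫ i)
    exact ⟨_, _, _, hpb x h t ht.symm, hopen x h t ht.symm⟩
  have : Presheaf.IsLocallySurjective zariskiTopology (Sigma.desc z) := by
    refine ⟨fun {Y} t ↦ ?_⟩
    obtain ⟨Y', f, s, _, _, hs⟩ := exists_etale_surjective_lift hF w (yonedaEquiv.symm t)
    obtain ⟨t', ht'⟩ := yoneda.map_surjective (yonedaEquiv.symm t ≫ i)
    have hst : s ≫ g = f ≫ t' := by
      apply yoneda.map_injective
      rw [Functor.map_comp, Functor.map_comp, ← hg, ht', reassoc_of% hs]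
    -- The point `y` lies in the image of `Z (x y)` for `x y` the image in `W` of a preimage of `y`
    -- in `Y'`.
    choose l hl using f.surjective
    let x (y : Y) : W := s (l y)
    have hcov : Presieve.ofArrows _ (fun y : Y ↦ pullback.snd (j (x y)) t') ∈
        (precoverage IsOpenImmersion).coverings Y := by
      refine (ofArrows_mem_precoverage_iff _).mpr
        ⟨fun y ↦ ⟨y, ?_⟩, fun y ↦ hopen (x y) _ t' ht'.symm⟩
      let O : Y'.Opens := s ⁻¹ᵁ V (x y)
      let r : O.toScheme ⟶ pullback (j (x y)) t' :=
        pullback.lift (s.resLE (V (x y)) O le_rfl ≫ π (x y)) (O.ι ≫ f) (by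
          rw [Category.assoc, hfac, Hom.resLE_comp_ι_assoc, hst, Category.assoc])
      have hr : r ≫ pullback.snd (j (x y)) t' = O.ι ≫ f := pullback.lift_snd _ _ _
      have hO : l y ∈ O := hxV (x y)
      let y' : O.toScheme := ⟨l y, hO⟩
      have hy' : O.ι y' = l y := rfl
      refine ⟨r y', ?_⟩
      rw [← Scheme.Hom.comp_apply, hr, Scheme.Hom.comp_apply, hy', hl]
    refine zariskiTopology.superset_covering ?_ (Precoverage.generate_mem_toGrothendieck hcov)
    rw [Sieve.generate_le_iff]
    rintro _ _ ⟨y⟩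
    refine ⟨yonedaEquiv (yoneda.map (pullback.fst (j (x y)) t') ≫ Sigma.ι (fun x ↦ yoneda.obj (Z x)) (x y)), ?_⟩
    rw [← yonedaEquiv_comp, Category.assoc, Sigma.ι_desc, (hpb (x y) _ t' ht'.symm).w,
      ← yonedaEquiv_naturality, Equiv.apply_symm_apply]
  exact Scheme.LocalRepresentability.isRepresentable (F := ⟨F, hF'⟩) (X := Z) (f := z) hz'

end AlgebraicGeometry

namespace CategoryTheory

theorem IsPullback.of_comp_mono {C : Type*} [Category* C] {P A B X Y : C} {fst : P ⟶ A}
    {snd : P ⟶ B} {f : A ⟶ X} {g : B ⟶ X} (m : X ⟶ Y) [Mono m]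
    (h : IsPullback fst snd (f ≫ m) (g ≫ m)) : IsPullback fst snd f g :=
  ⟨⟨by simpa [← cancel_mono m] using h.w⟩,
    ⟨PullbackCone.IsLimit.mk _ (fun s ↦ h.lift s.fst s.snd (by rw [s.condition_assoc]))
      (by simp) (by simp)
      fun s m h₁ h₂ ↦ h.hom_ext (by simpa using h₁) (by simpa using h₂)⟩⟩

theorem Presheaf.isSheaf_of_isPullback {C : Type*} [Category* C] {J : GrothendieckTopology C}
    {P A B X : Cᵒᵖ ⥤ Type u} {fst : P ⟶ A} {snd : P ⟶ B} {f : A ⟶ X} {g : B ⟶ X}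
    (h : IsPullback fst snd f g) (hA : Presheaf.IsSheaf J A) (hB : Presheaf.IsSheaf J B)
    (hX : Presheaf.IsSheaf J X) : Presheaf.IsSheaf J P := by
  let f' : (⟨A, hA⟩ : Sheaf J (Type u)) ⟶ ⟨X, hX⟩ := ⟨f⟩
  let g' : (⟨B, hB⟩ : Sheaf J (Type u)) ⟶ ⟨X, hX⟩ := ⟨g⟩
  have h' := (IsPullback.of_hasPullback f' g').map (sheafToPresheaf J (Type u))
  exact (Presheaf.isSheaf_of_iso_iff (h.isoIsPullback _ _ h')).mpr (pullback f' g').property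

theorem Functor.relativelyRepresentable.of_comp_mono {C D : Type*} [Category* C] [Category* D]
    {F : C ⥤ D} {X Y Z : D} {f : X ⟶ Y} (m : Y ⟶ Z) [Mono m]
    (h : F.relativelyRepresentable (f ≫ m)) : F.relativelyRepresentable f := by
  intro a g
  obtain ⟨b, snd, fst, hb⟩ := h (g ≫ m)
  exact ⟨b, snd, fst, hb.of_comp_mono m⟩

end CategoryTheory

namespace AlgebraicGeometry

open Scheme

theorem isEtaleChart_yoneda_map {V U : Scheme.{u}} (f : V ⟶ U) [Etale f] :
    IsEtaleChart (yoneda.map f) :=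
  MorphismProperty.relative_map (P := @Etale) ‹_›

theorem _root_.IsEtaleChart.of_isPullback {V W : Scheme.{u}} {X Y : Scheme.{u}ᵒᵖ ⥤ Type u}
    {w : yoneda.obj W ⟶ Y} {a : yoneda.obj W ⟶ yoneda.obj V} {q : yoneda.obj V ⟶ X} {i : Y ⟶ X}
    (h : IsPullback a w q i) (hq : IsEtaleChart q) : IsEtaleChart w :=
  (MorphismProperty.relative_isStableUnderBaseChange (F := yoneda) (P := @Etale)).of_isPullback h hq

instance Etale.isStableUnderComposition :
    MorphismProperty.IsStableUnderComposition (@Etale.{u}) :=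
  MorphismProperty.IsMultiplicative.toIsStableUnderComposition

theorem _root_.IsEtaleChart.comp {V W : Scheme.{u}} {X : Scheme.{u}ᵒᵖ ⥤ Type u}
    {a : yoneda.obj V ⟶ X} (ha : IsEtaleChart a) (f : W ⟶ V) [Etale f] :
    IsEtaleChart (yoneda.map f ≫ a) :=
  (MorphismProperty.relative_isStableUnderComposition (F := yoneda) (P := @Etale)).comp_mem _ _
    (isEtaleChart_yoneda_map f) ha

theorem isLocallySurjective_of_isPullback {P A B X : Scheme.{u}ᵒᵖ ⥤ Type u} {fst : P ⟶ A}
    {snd : P ⟶ B} {f : A ⟶ X} {g : B ⟶ X} (h : IsPullback fst snd f g)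
    (hf : ∀ ⦃T : Scheme.{u}⦄ (t : yoneda.obj T ⟶ X), ∃ (T' : Scheme.{u}) (e : T' ⟶ T)
      (s : yoneda.obj T' ⟶ A), Etale e ∧ Surjective e ∧ s ≫ f = yoneda.map e ≫ t) :
    Presheaf.IsLocallySurjective etaleTopology snd := by
  refine isLocallySurjective_of_exists_lift _ fun T t ↦ ?_
  obtain ⟨T', e, s, he, he', hs⟩ := hf (t ≫ g)
  exact ⟨T', e, h.lift s (yoneda.map e ≫ t) (by simpa using hs), he, he', h.lift_snd _ _ _⟩

theorem isRepresentable_of_mono_of_isEtaleChart {F : Scheme.{u}ᵒᵖ ⥤ Type u}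
    (hF : Presheaf.IsSheaf etaleTopology F) {T W : Scheme.{u}} (i : F ⟶ yoneda.obj T) [Mono i]
    (w : yoneda.obj W ⟶ F) [Presheaf.IsLocallySurjective etaleTopology w] (hw : IsEtaleChart w)
    (g : W ⟶ T) (hg : w ≫ i = yoneda.map g) [LocallyOfFiniteType g] : F.IsRepresentable := by
  have h : IsPullback (yoneda.map (pullback.fst g g)) (yoneda.map (pullback.snd g g)) w w := by
    have := (IsPullback.of_hasPullback g g).map yoneda
    rw [← hg] at this
    exact this.of_comp_mono i
  have : Etale (pullback.fst g g) := hw.property w _ _ h.flip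
  exact isRepresentable_of_mono hF i w g hg

end AlgebraicGeometry

/-! ### Presentations, representable diagonals and étale charts. -/

namespace AlgebraicGeometry

open Scheme

/-- The quotient map of an étale equivalence relation in schemes. -/
structure IsEtalePresentation {R U : Scheme.{u}} {X : Scheme.{u}ᵒᵖ ⥤ Type u} (p₁ p₂ : R ⟶ U)
    (q : yoneda.obj U ⟶ X) : Prop where
  isSheaf : Presheaf.IsSheaf etaleTopology X
  isKernelPair : IsKernelPair q (yoneda.map p₁) (yoneda.map p₂)
  isLocallySurjective : Presheaf.IsLocallySurjective etaleTopology q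
  etale_fst : Etale p₁
  etale_snd : Etale p₂

theorem IsEtalePresentation.isAlgebraicSpace {R U : Scheme.{u}} {X : Scheme.{u}ᵒᵖ ⥤ Type u}
    {p₁ p₂ : R ⟶ U} {q : yoneda.obj U ⟶ X} (h : IsEtalePresentation p₁ p₂ q) :
    IsAlgebraicSpace X := by
  have := h.isLocallySurjective
  exact ⟨h.isSheaf, R, U, p₁, p₂, q, ⟨IsKernelPair.of_map_yoneda h.isKernelPair, h.etale_fst,
    h.etale_snd⟩, .of_isKernelPair h.isSheaf h.isKernelPair⟩

theorem _root_.IsAlgebraicSpace.exists_isEtalePresentation {X : Scheme.{u}ᵒᵖ ⥤ Type u}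
    (hX : IsAlgebraicSpace X) : ∃ (R U : Scheme.{u}) (p₁ p₂ : R ⟶ U) (q : yoneda.obj U ⟶ X),
      IsEtalePresentation p₁ p₂ q := by
  obtain ⟨hX, R, U, p₁, p₂, q, hR, hq⟩ := hX
  exact ⟨R, U, p₁, p₂, q, hX, hq.isKernelPair hR.isEquivalenceRelation.map_yoneda
    (isSheaf_etaleTopology_yoneda R) (isSheaf_etaleTopology_yoneda U), hq.isLocallySurjective_π,
    hR.etale_fst, hR.etale_snd⟩

variable {T₁ T₂ : Scheme.{u}}

/-- The map to the product of two schemes given by its components. -/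
noncomputable def yonedaProdLift {F : Scheme.{u}ᵒᵖ ⥤ Type u} (a : F ⟶ yoneda.obj T₁)
    (b : F ⟶ yoneda.obj T₂) : F ⟶ yoneda.obj (T₁ ⨯ T₂) :=
  prod.lift a b ≫ (PreservesLimitPair.iso yoneda T₁ T₂).inv

@[simp]
theorem yonedaProdLift_fst {F : Scheme.{u}ᵒᵖ ⥤ Type u} (a : F ⟶ yoneda.obj T₁)
    (b : F ⟶ yoneda.obj T₂) : yonedaProdLift a b ≫ yoneda.map prod.fst = a := by
  simpa [yonedaProdLift] using prod.lift_fst a b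

@[simp]
theorem yonedaProdLift_snd {F : Scheme.{u}ᵒᵖ ⥤ Type u} (a : F ⟶ yoneda.obj T₁)
    (b : F ⟶ yoneda.obj T₂) : yonedaProdLift a b ≫ yoneda.map prod.snd = b := by
  simpa [yonedaProdLift] using prod.lift_snd a b

theorem hom_ext_yonedaProd {F : Scheme.{u}ᵒᵖ ⥤ Type u} {x y : F ⟶ yoneda.obj (T₁ ⨯ T₂)}
    (h₁ : x ≫ yoneda.map prod.fst = y ≫ yoneda.map prod.fst)
    (h₂ : x ≫ yoneda.map prod.snd = y ≫ yoneda.map prod.snd) : x = y := by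
  rw [← cancel_mono (PreservesLimitPair.iso yoneda T₁ T₂).hom]
  ext1
  · simpa using h₁
  · simpa using h₂

theorem mono_yonedaProdLift {X F : Scheme.{u}ᵒᵖ ⥤ Type u} {g₁ : yoneda.obj T₁ ⟶ X}
    {g₂ : yoneda.obj T₂ ⟶ X} {a : F ⟶ yoneda.obj T₁} {b : F ⟶ yoneda.obj T₂}
    (h : IsPullback a b g₁ g₂) : Mono (yonedaProdLift a b) :=
  ⟨fun x y hxy ↦ h.hom_ext (by simpa using hxy =≫ yoneda.map prod.fst)
    (by simpa using hxy =≫ yoneda.map prod.snd)⟩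

namespace IsEtalePresentation

variable {R U : Scheme.{u}} {X : Scheme.{u}ᵒᵖ ⥤ Type u} {p₁ p₂ : R ⟶ U} {q : yoneda.obj U ⟶ X}

theorem exists_lift (h : IsEtalePresentation p₁ p₂ q) {T : Scheme.{u}} (t : yoneda.obj T ⟶ X) :
    ∃ (T' : Scheme.{u}) (f : T' ⟶ T) (s : T' ⟶ U), Etale f ∧ Surjective f ∧
      yoneda.map s ≫ q = yoneda.map f ≫ t :=
  have := h.isLocallySurjective
  exists_etale_surjective_lift h.isSheaf q t

/-- Maps from schemes to an algebraic space are representable. -/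
theorem relativelyRepresentable (h : IsEtalePresentation p₁ p₂ q) (g₁ : yoneda.obj T₁ ⟶ X) :
    IsRepresentableMap g₁ := by
  intro T₂ g₂
  let F := pullback g₁ g₂
  have hF : Presheaf.IsSheaf etaleTopology F :=
    Presheaf.isSheaf_of_isPullback (.of_hasPullback g₁ g₂) (isSheaf_etaleTopology_yoneda _)
      (isSheaf_etaleTopology_yoneda _) h.isSheaf
  let i : F ⟶ yoneda.obj (T₁ ⨯ T₂) := yonedaProdLift (pullback.fst g₁ g₂) (pullback.snd g₁ g₂)
  have hi₁ : i ≫ yoneda.map prod.fst = pullback.fst g₁ g₂ := yonedaProdLift_fst _ _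
  have hi₂ : i ≫ yoneda.map prod.snd = pullback.snd g₁ g₂ := yonedaProdLift_snd _ _
  have : Mono i := mono_yonedaProdLift (.of_hasPullback g₁ g₂)
  obtain ⟨T', f, a, b, _, _, ha, hb⟩ : ∃ (T' : Scheme.{u}) (f : T' ⟶ T₁ ⨯ T₂) (a b : T' ⟶ U),
      Etale f ∧ Surjective f ∧ yoneda.map a ≫ q = yoneda.map (f ≫ prod.fst) ≫ g₁ ∧
      yoneda.map b ≫ q = yoneda.map (f ≫ prod.snd) ≫ g₂ := by
    obtain ⟨T', f, a, _, _, ha⟩ := h.exists_lift (yoneda.map (prod.fst : T₁ ⨯ T₂ ⟶ _) ≫ g₁)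
    obtain ⟨T'', f', b, _, _, hb⟩ := h.exists_lift (yoneda.map (f ≫ prod.snd) ≫ g₂)
    exact ⟨T'', f' ≫ f, f' ≫ a, b, inferInstance, inferInstance, by simp [ha], by simp [hb]⟩
  have := h.etale_fst
  have : LocallyOfFiniteType (prod.lift p₁ p₂) := by
    have : LocallyOfFiniteType (prod.lift p₁ p₂ ≫ prod.fst) := by
      rw [prod.lift_fst]
      infer_instance
    exact locallyOfFiniteType_of_comp _ prod.fst
  -- `W = T' ×[U × U] R` is the restriction of the subsheaf `F` to the cover `T'`, since two maps to
  -- `U` agree in `X` exactly when they come from `R`.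
  let W := pullback (prod.lift a b) (prod.lift p₁ p₂)
  let c : W ⟶ T' := pullback.fst _ _
  let r : W ⟶ R := pullback.snd _ _
  have hcr : c ≫ prod.lift a b = r ≫ prod.lift p₁ p₂ := pullback.condition
  have hca : c ≫ a = r ≫ p₁ := by
    have := hcr =≫ prod.fst
    rwa [Category.assoc, Category.assoc, prod.lift_fst, prod.lift_fst] at this
  have hcb : c ≫ b = r ≫ p₂ := by
    have := hcr =≫ prod.snd
    rwa [Category.assoc, Category.assoc, prod.lift_snd, prod.lift_snd] at this
  let w : yoneda.obj W ⟶ F := pullback.lift (yoneda.map (c ≫ f ≫ prod.fst))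
    (yoneda.map (c ≫ f ≫ prod.snd)) (by
      rw [Functor.map_comp_assoc, ← ha, Functor.map_comp_assoc, ← hb, ← Functor.map_comp_assoc,
        ← Functor.map_comp_assoc, hca, hcb, Functor.map_comp_assoc, Functor.map_comp_assoc,
        h.isKernelPair.w])
  have hw : w ≫ i = yoneda.map (c ≫ f) := by
    apply hom_ext_yonedaProd
    · rw [Category.assoc, hi₁, pullback.lift_fst, ← Functor.map_comp, Category.assoc]
    · rw [Category.assoc, hi₂, pullback.lift_snd, ← Functor.map_comp, Category.assoc]
  have hpb : IsPullback (yoneda.map c) w (yoneda.map f) i := by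
    refine isPullback_of_forall_yoneda (by rw [hw, Functor.map_comp]) ?_ ?_
    · intro T x y hx hy
      obtain ⟨x, rfl⟩ := yoneda.map_surjective x
      obtain ⟨y, rfl⟩ := yoneda.map_surjective y
      have hxy : x ≫ c = y ≫ c := yoneda.map_injective (by simpa using hx)
      congr 1
      refine pullback.hom_ext hxy (yoneda.map_injective (h.isKernelPair.hom_ext ?_ ?_))
      · simp only [← Functor.map_comp]
        rw [Category.assoc, Category.assoc, ← hca, reassoc_of% hxy]
      · simp only [← Functor.map_comp]
        rw [Category.assoc, Category.assoc, ← hcb, reassoc_of% hxy]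
    · intro T d x hdx
      obtain ⟨d, rfl⟩ := yoneda.map_surjective d
      have h₁ : yoneda.map (d ≫ a) ≫ q = x ≫ pullback.fst g₁ g₂ ≫ g₁ := by
        rw [Functor.map_comp_assoc, ha, ← hi₁, Functor.map_comp_assoc, reassoc_of% hdx]
        simp only [Category.assoc]
      have h₂ : yoneda.map (d ≫ b) ≫ q = x ≫ pullback.snd g₁ g₂ ≫ g₂ := by
        rw [Functor.map_comp_assoc, hb, ← hi₂, Functor.map_comp_assoc, reassoc_of% hdx]
        simp only [Category.assoc]
      obtain ⟨s, hs⟩ := yoneda.map_surjective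
        (h.isKernelPair.lift _ _ (h₁.trans ((x ≫= pullback.condition).trans h₂.symm)))
      have hs₁ : s ≫ p₁ = d ≫ a := yoneda.map_injective (by
        rw [Functor.map_comp, hs, h.isKernelPair.lift_fst])
      have hs₂ : s ≫ p₂ = d ≫ b := yoneda.map_injective (by
        rw [Functor.map_comp, hs, h.isKernelPair.lift_snd])
      let l : T ⟶ W := pullback.lift d s (by
        ext
        · rw [Category.assoc, Category.assoc, prod.lift_fst, prod.lift_fst, hs₁]
        · rw [Category.assoc, Category.assoc, prod.lift_snd, prod.lift_snd, hs₂])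
      have hl : l ≫ c = d := pullback.lift_fst _ _ _
      refine ⟨yoneda.map l, by rw [← Functor.map_comp, hl], ?_⟩
      rw [← cancel_mono i, Category.assoc, hw, ← Functor.map_comp, reassoc_of% hl, ← hdx,
        Functor.map_comp]
  have hwS : Presheaf.IsLocallySurjective etaleTopology w :=
    isLocallySurjective_of_isPullback hpb fun T t ↦ by
      obtain ⟨t, rfl⟩ := yoneda.map_surjective t
      refine ⟨_, pullback.snd f t, yoneda.map (pullback.fst f t), inferInstance, inferInstance, ?_⟩
      rw [← Functor.map_comp, ← Functor.map_comp, pullback.condition]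
  obtain ⟨P, ⟨e⟩⟩ := isRepresentable_of_mono_of_isEtaleChart hF i w
    (.of_isPullback hpb (isEtaleChart_yoneda_map f)) (c ≫ f) hw
  let e' := Functor.representableByEquiv e
  obtain ⟨s, hs⟩ := yoneda.map_surjective (e'.hom ≫ pullback.snd g₁ g₂)
  refine ⟨P, s, e'.hom ≫ pullback.fst g₁ g₂, ?_⟩
  rw [hs]
  exact (IsPullback.of_hasPullback g₁ g₂).of_iso e'.symm (.refl _) (.refl _) (.refl _)
    (by simp) (by simp) (by simp) (by simp)

end IsEtalePresentation

end AlgebraicGeometry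

namespace AlgebraicGeometry

open Scheme

theorem _root_.IsAlgebraicSpace.isRepresentableMap {X : Scheme.{u}ᵒᵖ ⥤ Type u}
    (hX : IsAlgebraicSpace X) {T : Scheme.{u}} (g : yoneda.obj T ⟶ X) : IsRepresentableMap g := by
  obtain ⟨R, U, p₁, p₂, q, h⟩ := hX.exists_isEtalePresentation
  exact h.relativelyRepresentable g

/-- The diagonal of an algebraic space is representable. -/
theorem _root_.IsAlgebraicSpace.isRepresentableMap_diag {X : Scheme.{u}ᵒᵖ ⥤ Type u}
    (hX : IsAlgebraicSpace X) : IsRepresentableMap (diag X) :=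
  Functor.relativelyRepresentable.diag_of_map_from_obj fun _ g ↦ hX.isRepresentableMap g

/-- The relative diagonal of a map from an algebraic space is representable. -/
theorem _root_.IsAlgebraicSpace.isRepresentableMap_diagonal {X S : Scheme.{u}ᵒᵖ ⥤ Type u}
    (hX : IsAlgebraicSpace X) (f : X ⟶ S) : IsRepresentableMap (pullback.diagonal f) := by
  let m : pullback f f ⟶ X ⨯ X := prod.lift (pullback.fst f f) (pullback.snd f f)
  have : Mono m := ⟨fun a b h ↦ pullback.hom_ext (by
    have := h =≫ prod.fst
    rwa [Category.assoc, Category.assoc, prod.lift_fst] at this)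
    (by
    have := h =≫ prod.snd
    rwa [Category.assoc, Category.assoc, prod.lift_snd] at this)⟩
  refine .of_comp_mono m ?_
  have : pullback.diagonal f ≫ m = diag X := by ext1 <;> simp [m]
  rw [this]
  exact hX.isRepresentableMap_diag

/-- The quotient map of an étale equivalence relation in schemes is étale. -/
theorem IsEtalePresentation.isEtaleChart {R U : Scheme.{u}} {X : Scheme.{u}ᵒᵖ ⥤ Type u}
    {p₁ p₂ : R ⟶ U} {q : yoneda.obj U ⟶ X} (h : IsEtalePresentation p₁ p₂ q) :
    IsEtaleChart q := by
  have : MorphismProperty.RespectsIso @Etale :=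
    MorphismProperty.IsStableUnderBaseChange.respectsIso
  refine MorphismProperty.relative.of_exists fun T g ↦ ?_
  obtain ⟨P, s, t, hP⟩ := h.relativelyRepresentable q g
  refine ⟨P, t, s, hP, ?_⟩
  obtain ⟨t, rfl⟩ := yoneda.map_surjective t
  obtain ⟨T', f, a, _, _, ha⟩ := h.exists_lift g
  have := h.etale_snd
  have h₁ : IsPullback (yoneda.map (pullback.fst s f ≫ t)) (yoneda.map (pullback.snd s f)) q
      (yoneda.map a ≫ q) := by
    rw [ha, Functor.map_comp]
    exact ((IsPullback.of_hasPullback s f).map yoneda).flip.paste_vert hP.flip |>.flip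
  -- Over a cover that lifts to `U`, the base change of `q` is a base change of `p₂`, hence étale.
  have h₂ : IsPullback (yoneda.map (pullback.fst p₂ a ≫ p₁)) (yoneda.map (pullback.snd p₂ a)) q
      (yoneda.map a ≫ q) := by
    rw [Functor.map_comp]
    exact ((IsPullback.of_hasPullback p₂ a).map yoneda).flip.paste_vert h.isKernelPair.flip |>.flip
  have : Etale (pullback.snd s f) := by
    obtain ⟨e, he⟩ : ∃ e : pullback s f ≅ pullback p₂ a,
        e.hom ≫ pullback.snd p₂ a = pullback.snd s f := by
      refine ⟨yoneda.preimageIso (h₁.isoIsPullback _ _ h₂), yoneda.map_injective ?_⟩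
      simp
    rw [← he]
    infer_instance
  have : Etale (pullback.fst s f ≫ s) := by
    rw [pullback.condition]
    infer_instance
  exact Etale.of_comp_of_surjective (pullback.fst s f) s

end AlgebraicGeometry

/-! ### Quotients of algebraic spaces by étale equivalence relations. -/

namespace AlgebraicGeometry

open Scheme

/-- Base change of an étale chart along a map from a scheme, with scheme-valued projections. -/
theorem _root_.IsEtaleChart.exists_isPullback {V T : Scheme.{u}} {X : Scheme.{u}ᵒᵖ ⥤ Type u}
    {a : yoneda.obj V ⟶ X} (ha : IsEtaleChart a) (g : yoneda.obj T ⟶ X) :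
    ∃ (P : Scheme.{u}) (fst : P ⟶ V) (snd : P ⟶ T), Etale snd ∧
      IsPullback (yoneda.map fst) (yoneda.map snd) a g := by
  obtain ⟨P, snd, fst, h⟩ := ha.rep g
  obtain ⟨fst, rfl⟩ := yoneda.map_surjective fst
  exact ⟨P, fst, snd, ha.property _ _ _ h, h⟩

/-- The quotient sheaf of an étale equivalence relation in algebraic spaces is an algebraic
space. -/
theorem _root_.IsEtaleEquivRel.isAlgebraicSpace {R U X : Scheme.{u}ᵒᵖ ⥤ Type u} {p₁ p₂ : R ⟶ U}
    (hR : IsEtaleEquivRel p₁ p₂) {q : U ⟶ X} (hq : IsEtaleQuotient p₁ p₂ q) :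
    IsAlgebraicSpace X := by
  have hK : IsKernelPair q p₁ p₂ := hq.isKernelPair hR.isEquivalenceRelation
    hR.isAlgebraicSpace_rel.1 hR.isAlgebraicSpace_obj.1
  obtain ⟨_, U₀, _, _, u, hu⟩ := hR.isAlgebraicSpace_obj.exists_isEtalePresentation
  obtain ⟨_, V, _, _, v, hv⟩ := hR.isAlgebraicSpace_rel.exists_isEtalePresentation
  let R₀ := pullback (u ≫ q) (u ≫ q)
  let d₁ : R₀ ⟶ yoneda.obj U₀ := pullback.fst _ _
  let d₂ : R₀ ⟶ yoneda.obj U₀ := pullback.snd _ _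
  have hd : IsPullback d₁ d₂ (u ≫ q) (u ≫ q) := .of_hasPullback _ _
  have hR₀ : Presheaf.IsSheaf etaleTopology R₀ :=
    Presheaf.isSheaf_of_isPullback hd (isSheaf_etaleTopology_yoneda _)
      (isSheaf_etaleTopology_yoneda _) hq.isSheaf
  let i : R₀ ⟶ yoneda.obj (U₀ ⨯ U₀) := yonedaProdLift d₁ d₂
  have : Mono i := mono_yonedaProdLift hd
  let ρ : R₀ ⟶ R := hK.lift (d₁ ≫ u) (d₂ ≫ u) (by simpa using hd.w)
  have hρ₁ : ρ ≫ p₁ = d₁ ≫ u := hK.lift_fst _ _ _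
  have hρ₂ : ρ ≫ p₂ = d₂ ≫ u := hK.lift_snd _ _ _
  -- Two successive fibre products with the chart `u` build `W = R₀ ×[R] V`; it is étale over `V`,
  -- hence an étale chart of `R`, and definition `IsEtaleMap` makes both maps `W ⟶ U₀` étale.
  obtain ⟨W₁, t₁, s₁, _, h₁⟩ := hu.isEtaleChart.exists_isPullback (v ≫ p₁)
  obtain ⟨W, t₂, s₂, _, h₂⟩ := hu.isEtaleChart.exists_isPullback (yoneda.map s₁ ≫ v ≫ p₂)
  have hr₁ : yoneda.map (s₂ ≫ t₁) ≫ u = (yoneda.map (s₂ ≫ s₁) ≫ v) ≫ p₁ := by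
    simp [h₁.w]
  have hr₂ : yoneda.map t₂ ≫ u = (yoneda.map (s₂ ≫ s₁) ≫ v) ≫ p₂ := by
    simp [h₂.w]
  have hchart : IsEtaleChart (yoneda.map (s₂ ≫ s₁) ≫ v) := hv.isEtaleChart.comp _
  have hE₁ : Etale (s₂ ≫ t₁) := hR.etale_fst _ _ _ hchart hu.isEtaleChart hr₁.symm
  have hE₂ : Etale t₂ := hR.etale_snd _ _ _ hchart hu.isEtaleChart hr₂.symm
  let w : yoneda.obj W ⟶ R₀ := hd.lift (yoneda.map (s₂ ≫ t₁)) (yoneda.map t₂) (by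
    rw [reassoc_of% hr₁, reassoc_of% hr₂, hK.w])
  have hw₁ : w ≫ d₁ = yoneda.map (s₂ ≫ t₁) := hd.lift_fst _ _ _
  have hw₂ : w ≫ d₂ = yoneda.map t₂ := hd.lift_snd _ _ _
  have hw : IsPullback (yoneda.map (s₂ ≫ s₁)) w v ρ := by
    refine isPullback_of_forall_yoneda (hK.hom_ext ?_ ?_) ?_ ?_
    · rw [← hr₁, Category.assoc, hρ₁, reassoc_of% hw₁]
    · rw [← hr₂, Category.assoc, hρ₂, reassoc_of% hw₂]
    · intro T x y hx hy
      refine h₂.hom_ext ?_ (h₁.hom_ext ?_ ?_)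
      · rw [← hw₂, reassoc_of% hy]
      · rw [Category.assoc, Category.assoc, ← Functor.map_comp, ← hw₁, reassoc_of% hy]
      · simpa using hx
    · intro T x y hxy
      refine ⟨h₂.lift (y ≫ d₂) (h₁.lift (y ≫ d₁) x ?_) ?_, ?_, hd.hom_ext ?_ ?_⟩
      · rw [reassoc_of% hxy, hρ₁, Category.assoc]
      · rw [h₁.lift_snd_assoc, reassoc_of% hxy, hρ₂, Category.assoc]
      · simp
      · simp [hw₁]
      · simp [hw₂]
  have hwS : Presheaf.IsLocallySurjective etaleTopology w :=
    isLocallySurjective_of_isPullback hw fun T t ↦ by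
      obtain ⟨T', f, s, hf, hf', h⟩ := hv.exists_lift t
      exact ⟨T', f, yoneda.map s, hf, hf', h⟩
  have hwE : IsEtaleChart w := .of_isPullback hw hv.isEtaleChart
  let g : W ⟶ U₀ ⨯ U₀ := prod.lift (s₂ ≫ t₁) t₂
  have hwg : w ≫ i = yoneda.map g := by
    apply hom_ext_yonedaProd
    · rw [Category.assoc, yonedaProdLift_fst, hw₁, ← Functor.map_comp, prod.lift_fst]
    · rw [Category.assoc, yonedaProdLift_snd, hw₂, ← Functor.map_comp, prod.lift_snd]
  have : LocallyOfFiniteType g := by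
    have : LocallyOfFiniteType (g ≫ prod.fst) := by
      rw [prod.lift_fst]
      infer_instance
    exact locallyOfFiniteType_of_comp g prod.fst
  obtain ⟨P, ⟨e⟩⟩ := isRepresentable_of_mono_of_isEtaleChart hR₀ i w hwE g hwg
  let e' := Functor.representableByEquiv e
  obtain ⟨a₁, ha₁⟩ := yoneda.map_surjective (e'.hom ≫ d₁)
  obtain ⟨a₂, ha₂⟩ := yoneda.map_surjective (e'.hom ≫ d₂)
  obtain ⟨w', hw'⟩ := yoneda.map_surjective (w ≫ e'.inv)
  have : Etale w' := hwE.property e'.hom (𝟙 _) w' (by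
    rw [hw']
    exact IsPullback.of_horiz_isIso ⟨by simp⟩)
  have : Surjective w' := by
    obtain ⟨P', f, s, _, _, hs⟩ := exists_etale_surjective_lift hR₀ w e'.hom
    have : s ≫ w' = f := yoneda.map_injective (by
      rw [Functor.map_comp, hw', reassoc_of% hs, e'.hom_inv_id, Category.comp_id])
    subst this
    exact .of_comp s w'
  have hwa₁ : w' ≫ a₁ = s₂ ≫ t₁ := yoneda.map_injective (by
    rw [Functor.map_comp, hw', ha₁, Category.assoc, e'.inv_hom_id_assoc, hw₁])
  have hwa₂ : w' ≫ a₂ = t₂ := yoneda.map_injective (by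
    rw [Functor.map_comp, hw', ha₂, Category.assoc, e'.inv_hom_id_assoc, hw₂])
  have hpres : IsEtalePresentation a₁ a₂ (u ≫ q) :=
    { isSheaf := hq.isSheaf
      isKernelPair := by
        rw [ha₁, ha₂]
        exact hd.of_iso e'.symm (.refl _) (.refl _) (.refl _) (by simp) (by simp) (by simp)
          (by simp)
      isLocallySurjective := by
        have := hu.isLocallySurjective
        have := hq.isLocallySurjective_π
        infer_instance
      etale_fst := by
        rw [← hwa₁] at hE₁
        exact .of_comp_of_surjective w' a₁
      etale_snd := by
        rw [← hwa₂] at hE₂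
        exact .of_comp_of_surjective w' a₂ }
  exact hpres.isAlgebraicSpace

end AlgebraicGeometry

/-! ### Existence of the quotient sheaf in the same universe. -/

namespace AlgebraicGeometry

open Scheme

/-- Up to isomorphism, there is only a small set of affine schemes étale over a given scheme. -/
theorem exists_small_etale_family (T : Scheme.{u}) :
    ∃ (E : Type u) (V : E → Scheme.{u}) (v : ∀ e, V e ⟶ T),
      ∀ ⦃A : CommRingCat.{u}⦄ (f : Spec A ⟶ T), Etale f →
        ∃ (e : E) (ι : Spec A ≅ V e), ι.hom ≫ v e = f := by
  let G : AffineEtale T ⥤ Scheme.{u} := AffineEtale.Spec T ⋙ Etale.forget T ⋙ Over.forget T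
  let eqv := equivSmallModel.{u} (AffineEtale T)
  refine ⟨SmallModel.{u} (AffineEtale T), fun e ↦ G.obj (eqv.inverse.obj e),
    fun e ↦ ((AffineEtale.Spec T).obj (eqv.inverse.obj e)).hom, fun A f _ ↦ ?_⟩
  let a : AffineEtale T := AffineEtale.mk f
  exact ⟨eqv.functor.obj a, G.mapIso (eqv.unitIso.app a),
    MorphismProperty.Over.w ((AffineEtale.Spec T).map (eqv.unitIso.hom.app a))⟩

/-- Sections of an étale sheaf that is étale-locally generated by a small presheaf form a small
type. -/
theorem small_of_isLocallySurjective {P : Scheme.{u}ᵒᵖ ⥤ Type u}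
    {F : Scheme.{u}ᵒᵖ ⥤ Type (u + 1)} (hF : Presieve.IsSheaf etaleTopology F)
    (η : P ⋙ uliftFunctor.{u + 1} ⟶ F) [Presheaf.IsLocallySurjective etaleTopology η]
    (T : Scheme.{u}) : Small.{u} (F.obj (Opposite.op T)) := by
  obtain ⟨E, V, v, hv⟩ := exists_small_etale_family T
  -- A section `x` is recorded by its local lifts to `P` over the small family of étale affines.
  -- Affines over which `x` lifts cover `T`, so sections with equal records agree.
  let Φ (x : F.obj (Opposite.op T)) (e : E) : Set (P.obj (Opposite.op (V e))) :=
    {p | η.app _ ⟨p⟩ = F.map (v e).op x}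
  refine small_of_injective (β := ∀ e : E, Set (P.obj (Opposite.op (V e)))) (f := Φ) ?_
  intro x y hxy
  have key {A : CommRingCat.{u}} (f : Spec A ⟶ T) (hf : Etale f)
      (p : P.obj (Opposite.op (Spec A))) (hp : η.app _ ⟨p⟩ = F.map f.op x) :
      η.app _ ⟨p⟩ = F.map f.op y := by
    obtain ⟨e, ι, rfl⟩ := hv f hf
    have hη {Y Z : Scheme.{u}} (g : Y ⟶ Z) (p : P.obj (Opposite.op Z)) :
        η.app _ ⟨P.map g.op p⟩ = F.map g.op (η.app _ ⟨p⟩) :=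
      NatTrans.naturality_apply η g.op ⟨p⟩
    have h₁ : P.map ι.inv.op p ∈ Φ x e := by
      change η.app _ _ = _
      rw [hη, hp, ← Functor.map_comp_apply, ← op_comp, ι.inv_hom_id_assoc]
    rw [hxy] at h₁
    replace h₁ : η.app _ ⟨P.map ι.inv.op p⟩ = F.map (v e).op y := h₁
    rw [op_comp, Functor.map_comp_apply, ← h₁, ← hη, ← Functor.map_comp_apply, ← op_comp,
      ι.hom_inv_id, op_id, Functor.map_id_apply]
  have hS : Presheaf.imageSieve η x ∈ etaleTopology T := Presheaf.imageSieve_mem _ _ _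
  obtain ⟨𝒰, h𝒰⟩ := mem_grothendieckTopology_iff.mp hS
  refine (hF.isSheafFor _ 𝒰.mem_grothendieckTopology).isSeparatedFor.ext ?_
  rintro _ _ ⟨i⟩
  refine (hF.isSheafFor _ (zariskiTopology_le_etaleTopology _
    (𝒰.X i).affineCover.mem_grothendieckTopology)).isSeparatedFor.ext ?_
  rintro _ _ ⟨j⟩
  obtain ⟨⟨p⟩, hp⟩ := (Presheaf.imageSieve η x).downward_closed (h𝒰 _ _ ⟨i⟩)
    ((𝒰.X i).affineCover.f j)
  have : Etale (𝒰.f i) := 𝒰.map_prop i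
  rw [← Functor.map_comp_apply, ← Functor.map_comp_apply, ← op_comp, ← hp]
  exact key _ (Etale.etale_comp ((𝒰.X i).affineCover.f j) (𝒰.f i)) p hp

end AlgebraicGeometry

namespace AlgebraicGeometry

open Scheme

/-- Sheafification on the big étale site does not enlarge the universe. -/
theorem exists_isSheaf_etaleTopology_locallyBijective (P : Scheme.{u}ᵒᵖ ⥤ Type u) :
    ∃ (X : Scheme.{u}ᵒᵖ ⥤ Type u) (φ : P ⟶ X), Presheaf.IsSheaf etaleTopology X ∧
      Presheaf.IsLocallyInjective etaleTopology φ ∧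
      Presheaf.IsLocallySurjective etaleTopology φ := by
  obtain ⟨F, η, hF, hinj, hsurj⟩ : ∃ (F : Scheme.{u}ᵒᵖ ⥤ Type (u + 1))
      (η : P ⋙ uliftFunctor.{u + 1} ⟶ F), Presieve.IsSheaf etaleTopology F ∧
      Presheaf.IsLocallyInjective etaleTopology η ∧ Presheaf.IsLocallySurjective etaleTopology η :=
    -- Sheafification on this large site is carried out in universe `u + 1`; the smallness of its
    -- sections then allows shrinking it back to `Type u`.
    ⟨_, etaleTopology.{u}.toSheafify (P ⋙ uliftFunctor.{u + 1}),
      (isSheaf_iff_isSheaf_of_type _ _).mp (etaleTopology.{u}.sheafify_isSheaf _),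
      Presheaf.isLocallyInjective_toSheafify etaleTopology.{u} _,
      Presheaf.isLocallySurjective_toSheafify etaleTopology.{u} _⟩
  have : FunctorToTypes.Small.{u} F := fun T ↦ small_of_isLocallySurjective hF η T.unop
  let X : Scheme.{u}ᵒᵖ ⥤ Type u := FunctorToTypes.shrink.{u} F
  have hη {Y Z : Scheme.{u}} (g : Y ⟶ Z) (p : P.obj (Opposite.op Z)) :
      η.app _ ⟨P.map g.op p⟩ = F.map g.op (η.app _ ⟨p⟩) :=
    NatTrans.naturality_apply η g.op ⟨p⟩
  have hX {Y Z : Scheme.{u}} (g : Y ⟶ Z) (x : F.obj (Opposite.op Z)) :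
      X.map g.op (equivShrink _ x) = equivShrink _ (F.map g.op x) := by
    simp [X]
  let φ : P ⟶ X :=
    { app T := ↾fun p ↦ equivShrink _ (η.app T ⟨p⟩)
      naturality T T' g := by
        ext p
        exact (congrArg _ (hη g.unop p)).trans (hX g.unop _).symm }
  have hφ {T : Scheme.{u}} (p : P.obj (Opposite.op T)) :
      φ.app _ p = equivShrink _ (η.app _ ⟨p⟩) := rfl
  refine ⟨X, φ, ?_, ⟨fun {T} p p' h ↦ ?_⟩, ⟨fun {T} x ↦ ?_⟩⟩
  · rw [isSheaf_iff_isSheaf_of_type]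
    refine (Presieve.isSheaf_iff_of_nat_equiv (fun T ↦ equivShrink _) ?_).mp hF
    intro T T' g x
    exact (hX g x).symm
  · have h' : η.app _ ⟨p⟩ = η.app _ ⟨p'⟩ := (equivShrink _).injective h
    refine etaleTopology.superset_covering (fun Y f hf ↦ ?_)
      (Presheaf.equalizerSieve_mem etaleTopology η _ _ h')
    exact congr($(hf).down)
  · obtain ⟨x, rfl⟩ := (equivShrink _).surjective x
    refine etaleTopology.superset_covering (fun Y f hf ↦ ?_)
      (Presheaf.imageSieve_mem etaleTopology η x)
    obtain ⟨⟨p⟩, hp⟩ := hf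
    exact ⟨p, by rw [hφ, hp, hX]⟩

theorem exists_isEtaleQuotient {R U : Scheme.{u}ᵒᵖ ⥤ Type u} (p₁ p₂ : R ⟶ U) :
    ∃ (X : Scheme.{u}ᵒᵖ ⥤ Type u) (q : U ⟶ X), IsEtaleQuotient p₁ p₂ q := by
  obtain ⟨X, φ, hX, hinj, hsurj⟩ :=
    exists_isSheaf_etaleTopology_locallyBijective (coequalizer p₁ p₂)
  have hw : p₁ ≫ coequalizer.π p₁ p₂ ≫ φ = p₂ ≫ coequalizer.π p₁ p₂ ≫ φ := by
    rw [coequalizer.condition_assoc]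
  have hφ : coequalizer.desc _ hw = φ :=
    coequalizer.hom_ext (coequalizer.π_desc _ _)
  exact ⟨X, coequalizer.π p₁ p₂ ≫ φ, hX, hw, by rwa [hφ], by rwa [hφ]⟩

end AlgebraicGeometry

theorem mainTheorem11 :
    -- the absolute diagonal `X ⟶ X × X` of an algebraic space is representable
    (∀ X : Scheme.{u}ᵒᵖ ⥤ Type u, IsAlgebraicSpace X → IsRepresentableMap (diag X)) ∧
    -- so is the relative diagonal `X ⟶ X ×_S X` of any map of algebraic spaces
    (∀ (X S : Scheme.{u}ᵒᵖ ⥤ Type u) (f : X ⟶ S), IsAlgebraicSpace X → IsAlgebraicSpace S →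
      IsRepresentableMap (pullback.diagonal f)) ∧
    -- the quotient of an étale equivalence relation in algebraic spaces exists and is an
    -- algebraic space
    (∀ (R U : Scheme.{u}ᵒᵖ ⥤ Type u) (p₁ p₂ : R ⟶ U), IsEtaleEquivRel p₁ p₂ →
      (∃ (X : Scheme.{u}ᵒᵖ ⥤ Type u) (q : U ⟶ X), IsEtaleQuotient p₁ p₂ q) ∧
      ∀ (X : Scheme.{u}ᵒᵖ ⥤ Type u) (q : U ⟶ X), IsEtaleQuotient p₁ p₂ q →
        IsAlgebraicSpace X) :=
  ⟨fun _ hX ↦ hX.isRepresentableMap_diag, fun _ _ f hX _ ↦ hX.isRepresentableMap_diagonal f,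
    fun _ _ p₁ p₂ hR ↦ ⟨exists_isEtaleQuotient p₁ p₂, fun _ _ hq ↦ hR.isAlgebraicSpace hq⟩⟩
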